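/- \textbf{Conventions.} A \emph{graph} $\Gamma$ consists of a vertex set $V\Gamma$, an arc set $A\Gamma$, maps $o,t\colon A\Gamma\to V\Gamma$ (origin, terminus) and a map $a\mapsto\bar a$ on $A\Gamma$ (reversal) with $\bar{\bar a}=a$ and $o(a)=t(\bar a)$; arcs with $\bar a=a$ (\emph{self-reverse} arcs) are allowed. A graph is \emph{simple} if it has no loops and an arc is determined by its origin and terminus; a \emph{tree} is a simple connected graph without cycles of length $\ge 3$. A \emph{permutation group action} $(G,X)$ is a subgroup $G\le\mathrm{Sym}(X)$ with $X\neq\emptyset$. If a group $G$ acts on a set containing $Y$, then $G^{Y}\le\mathrm{Sym}(Y)$ denotes the permutation group induced on $Y$ by the setwise stabiliser of $Y$ in $G$. Two actions $(H,Y)$, $(G,X)$ are \emph{isomorphic} if there are a group isomorphism $\varphi\colon H\to G$ and a bijection $\Phi\colon Y\to X$ with $\varphi(h)(\Phi(y))=\Phi(h(y))$ for all $h\in H$, $y\in Y$. An \emph{embedding} $(H,Y)\hookrightarrow(G,X)$ is an injection $\Phi\colon Y\to X$ that, with some group isomorphism $\varphi\colon H\to G^{\Phi(Y)}$, is an isomorphism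 from $(H,Y)$ to $(G^{\Phi(Y)},\Phi(Y))$. \textbf{Graphs of group actions.} A \emph{graph of group actions} $\mathcal G$ consists of a connected graph $\Delta$; for each $v\in V\Delta$ a permutation group action $(G(v),X(v))$; for each $a\in A\Delta$ a permutation group action $(H(a),Y(a))$ with $(H(\bar a),Y(\bar a))=(H(a),Y(a))$ and an embedding $\Phi_a\colon(H(a),Y(a))\hookrightarrow(G(t(a)),X(t(a)))$; and for each self-reverse arc $a$ a permutation $h_a$ of $Y(a)$ with $h_aH(a)h_a^{-1}=H(a)$ and $h_a^2\in H(a)$. The sets $X(v)$ $(v\in V\Delta)$ are regarded as pairwise disjoint, and so are the sets $Y(a)$ belonging to different edges $\{a,\bar a\}$. An \emph{$a$-adhesion map} is a map $\gamma\Phi_a\colon Y(a)\to X(t(a))$ with $\gamma\in G(t(a))$, an \emph{$a$-adhesion set} is the image of an $a$-adhesion map, and, for $a$ self-reverse, a \emph{twisted $a$-adhesion map} is a map $\gamma\Phi_ah_a$ with $\gamma\in G(t(a))$. \textbf{Scaffoldings.} Let $\Sigma$ be a graph with an equivalence relation $\sim$ on $V\Sigma$, and extend $\sim$ to $A\Sigma$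 by $a\sim b$ iff $o(a)\sim o(b)$ and $t(a)\sim t(b)$. The classes $[v]\subseteq V\Sigma$ and $[a]\subseteq A\Sigma$ are called vertex bundles and arc bundles; regarded as a vertex or an arc of the quotient graph $T_\Sigma=\Sigma/{\sim}$ they are written $[\![v]\!]$ and $[\![a]\!]$. A \emph{scaffolding} $(\Sigma,\sim,\pi,p)$ for $\mathcal G$ consists of such $\Sigma$ and $\sim$, a graph morphism $\pi\colon T_\Sigma\to\Delta$ and a map $p\colon V\Sigma\cup A\Sigma\to\bigcup_vX(v)\cup\bigcup_aY(a)$ such that $T_\Sigma$ is a tree, no arc has both ends in the same vertex bundle, and for all vertices $[\![v]\!]$ and arcs $[\![a]\!]$ of $T_\Sigma$: \begin{itemize} \item $p$ restricts to bijections $[v]\to X(\pi([\![v]\!]))$ and $[a]\to Y(\pi([\![a]\!]))$, and $p(\bar b)=p(b)$ for every $b\in A\Sigma$; \item let $\Psi_{[\![a]\!]}\colon Y(\pi([\![a]\!]))\to X(\pi(t([\![a]\!])))$ be the map with $\Psi_{[\![a]\!]}(p(b))=p(t(b))$ for all $b\in[a]$. If $\pi([\![a]\!])$ is not self-reverse,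 then $\Psi_{[\![a]\!]}$ is a $\pi([\![a]\!])$-adhesion map; if it is self-reverse, then one of $\Psi_{[\![a]\!]},\Psi_{[\![\bar a]\!]}$ is a $\pi([\![a]\!])$-adhesion map and the other is a twisted $\pi([\![a]\!])$-adhesion map; \item for every arc $b$ of $\Delta$ with $t(b)=\pi([\![v]\!])$ and every $b$-adhesion set $S\subseteq X(\pi([\![v]\!]))$ there is exactly one arc $[\![a]\!]$ of $T_\Sigma$ with $\pi([\![a]\!])=b$, $t([\![a]\!])=[\![v]\!]$ and $\Psi_{[\![a]\!]}(p([a]))=S$. \end{itemize} A \emph{scaffolding automorphism} is a graph automorphism $g$ of $\Sigma$ such that, for all $x,y\in V\Sigma\cup A\Sigma$, $x\sim y$ iff $g(x)\sim g(y)$, and $\pi([\![g(x)]\!])=\pi([\![x]\!])$. Its \emph{local action} at $[\![v]\!]$ is the permutation $g_{[\![v]\!]}$ of $X(\pi([\![v]\!]))$ with $p(g(w))=g_{[\![v]\!]}(p(w))$ for all $w\in[v]$. The \emph{universal group} of $\mathcal G$ (acting on $\Sigma$) is the group of all scaffolding automorphisms $g$ with $g_{[\![v]\!]}\in G(\pi([\![v]\!]))$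 for every vertex $[\![v]\!]$ of $T_\Sigma$. \textbf{Theorem.} Let $\mathcal G$ be a graph of group actions, let $\Sigma=(\Sigma,\sim,\pi,p)$ be any scaffolding for $\mathcal G$, and let $G$ be the universal group of $\mathcal G$, acting on $\Sigma$. \begin{enumerate} \item For every $v\in V\Sigma$, the action $(G^{[v]},[v])$ is isomorphic to $(G(\pi([\![v]\!])),X(\pi([\![v]\!])))$. \item For every $a\in A\Sigma$, the action $(G^{[a]},[a])$ is isomorphic to $(H(\pi([\![a]\!])),Y(\pi([\![a]\!])))$. \end{enumerate} -/

import Mathlib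

universe u₁ u₂ u₃ u₄ u₅ u₆

/-! ### Group actions -/

namespace ActionIso

/-- Two group actions `(G, X)` and `(H, Y)` are (permutationally) isomorphic. -/
def Isomorphic (G X H Y : Type*) [Group G] [MulAction G X] [Group H] [MulAction H Y] : Prop :=
  ∃ (φ : G ≃* H) (Φ : X ≃ Y), ∀ (g : G) (x : X), φ g • Φ x = Φ (g • x)

open scoped Pointwise in
/-- The permutation group `G^Y` on `Y ⊆ Ω` induced by the setwise stabiliser of `Y` in `G`. -/
def induced (G : Type*) {Ω : Type*} [Group G] [MulAction G Ω] (Y : Set Ω) :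
    Subgroup (Equiv.Perm Y) :=
  (MulAction.toPermHom (MulAction.stabilizer G Y) Y).range

/-- `Φ : Y ↪ X` is an embedding of the permutation group action `(H, Y)` into `(G, X)`: together
with some group isomorphism `φ : H ≃ G^{Φ(Y)}` it is a permutation isomorphism of `(H, Y)` onto
`(G^{Φ(Y)}, Φ(Y))`. (The isomorphism `φ` is determined by `Φ`.) -/
def IsEmbedding {X Y : Type*} (H : Subgroup (Equiv.Perm Y)) (G : Subgroup (Equiv.Perm X))
    (Φ : Y ↪ X) : Prop :=
  ∃ φ : H ≃* induced G (Set.range Φ), ∀ (h : H) (y : Y),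
    (((φ h : Equiv.Perm (Set.range Φ)) ⟨Φ y, Set.mem_range_self y⟩ : Set.range Φ) : X)
      = Φ ((h : Equiv.Perm Y) y)

end ActionIso

/-! ### Graphs in the sense of Serre (self-reverse arcs are allowed) -/

/-- A graph: vertices, arcs, origin, terminus and reversal of arcs. -/
structure SerreGraph : Type (max (u₁ + 1) (u₂ + 1)) where
  V : Type u₁
  A : Type u₂
  o : A → V
  t : A → V
  rev : A → A
  rev_rev : ∀ a, rev (rev a) = a
  o_eq : ∀ a, o a = t (rev a)

namespace SerreGraph

theorem t_eq (Γ : SerreGraph) (a : Γ.A) : Γ.t a = Γ.o (Γ.rev a) := by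
  rw [Γ.o_eq, Γ.rev_rev]

/-- The underlying simple graph. -/
def toSimple (Γ : SerreGraph) : SimpleGraph Γ.V where
  Adj u v := u ≠ v ∧ ∃ a, Γ.o a = u ∧ Γ.t a = v
  symm := ⟨by
    rintro u v ⟨hne, a, rfl, rfl⟩
    exact ⟨hne.symm, Γ.rev a, (Γ.t_eq a).symm, (Γ.o_eq a).symm⟩⟩
  loopless := ⟨fun _ h => h.1 rfl⟩

def Connected (Γ : SerreGraph) : Prop := Γ.toSimple.Connected

/-- No loops and no multiple arcs. -/
def IsSimple (Γ : SerreGraph) : Prop :=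
  (∀ a, Γ.o a ≠ Γ.t a) ∧ Function.Injective fun a => (Γ.o a, Γ.t a)

def IsTree (Γ : SerreGraph) : Prop := Γ.IsSimple ∧ Γ.toSimple.IsTree

/-- Arcs up to reversal. -/
def edgeSetoid (Γ : SerreGraph) : Setoid Γ.A where
  r a b := b = a ∨ b = Γ.rev a
  iseqv := by
    refine ⟨fun a => Or.inl rfl, ?_, ?_⟩
    · rintro a b (rfl | rfl)
      · exact Or.inl rfl
      · exact Or.inr (Γ.rev_rev a).symm
    · rintro a b c (rfl | rfl) (rfl | rfl)
      · exact Or.inl rfl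
      · exact Or.inr rfl
      · exact Or.inr rfl
      · exact Or.inl (Γ.rev_rev a)

/-- The edges of a graph: an edge consists of an arc and its reverse. -/
def E (Γ : SerreGraph) : Type _ := Quotient Γ.edgeSetoid

/-- The edge of an arc. -/
def edge (Γ : SerreGraph) (a : Γ.A) : Γ.E := Quotient.mk Γ.edgeSetoid a

/-- Graph morphisms. -/
structure Hom (Γ Δ : SerreGraph) where
  onV : Γ.V → Δ.V
  onA : Γ.A → Δ.A
  map_o : ∀ a, Δ.o (onA a) = onV (Γ.o a)
  map_t : ∀ a, Δ.t (onA a) = onV (Γ.t a)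
  map_rev : ∀ a, Δ.rev (onA a) = onA (Γ.rev a)

/-- The automorphism group of a graph, as a group of pairs of permutations of the vertices and of
the arcs. -/
def Aut (Γ : SerreGraph) : Subgroup (Equiv.Perm Γ.V × Equiv.Perm Γ.A) where
  carrier := {g | ∀ a, Γ.o (g.2 a) = g.1 (Γ.o a) ∧ Γ.t (g.2 a) = g.1 (Γ.t a) ∧
    Γ.rev (g.2 a) = g.2 (Γ.rev a)}
  one_mem' := fun _ => ⟨rfl, rfl, rfl⟩
  mul_mem' := by
    intro g h hg hh a
    simp [(hg _).1, (hg _).2.1, (hg _).2.2, (hh _).1, (hh _).2.1, (hh _).2.2]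
  inv_mem' := by
    intro g hg a
    obtain ⟨h1, h2, h3⟩ := hg (g.2⁻¹ a)
    have hinv : g.2 (g.2⁻¹ a) = a := g.2.apply_symm_apply a
    simp only [Prod.fst_inv, Prod.snd_inv]
    rw [hinv] at h1 h2 h3
    refine ⟨?_, ?_, ?_⟩
    · rw [h1]; exact (g.1.symm_apply_apply _).symm
    · rw [h2]; exact (g.1.symm_apply_apply _).symm
    · rw [h3]; exact (g.2.symm_apply_apply _).symm

/-- Automorphisms act on the vertices. -/
instance (Γ : SerreGraph) : MulAction Γ.Aut Γ.V where
  smul g v := g.1.1 v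
  one_smul _ := rfl
  mul_smul _ _ _ := rfl

/-- Automorphisms act on the arcs. -/
instance (Γ : SerreGraph) : MulAction Γ.Aut Γ.A where
  smul g a := g.1.2 a
  one_smul _ := rfl
  mul_smul _ _ _ := rfl

/-- The equivalence relation on arcs that an equivalence relation on the vertices induces: the
origins are equivalent and the termini are equivalent. -/
def arcSetoid (Γ : SerreGraph) (r : Setoid Γ.V) : Setoid Γ.A where
  r a b := r (Γ.o a) (Γ.o b) ∧ r (Γ.t a) (Γ.t b)
  iseqv := ⟨fun _ => ⟨r.refl' _, r.refl' _⟩, fun h => ⟨r.symm' h.1, r.symm' h.2⟩,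
    fun h k => ⟨r.trans' h.1 k.1, r.trans' h.2 k.2⟩⟩

/-- The quotient graph by an equivalence relation on the vertices and the induced equivalence
relation on the arcs. -/
def quotient (Γ : SerreGraph) (r : Setoid Γ.V) : SerreGraph where
  V := Quotient r
  A := Quotient (Γ.arcSetoid r)
  o := Quotient.lift (fun a => Quotient.mk r (Γ.o a)) fun _ _ h => Quotient.sound h.1
  t := Quotient.lift (fun a => Quotient.mk r (Γ.t a)) fun _ _ h => Quotient.sound h.2
  rev := Quotient.map Γ.rev fun a b h => by
    refine ⟨?_, ?_⟩
    · rw [← Γ.t_eq, ← Γ.t_eq]; exact h.2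
    · rw [← Γ.o_eq, ← Γ.o_eq]; exact h.1
  rev_rev := by
    rintro ⟨a⟩
    exact congrArg (Quotient.mk (Γ.arcSetoid r)) (Γ.rev_rev a)
  o_eq := by
    rintro ⟨a⟩
    exact congrArg (Quotient.mk r) (Γ.o_eq a)

end SerreGraph

/-! ### Graphs of group actions -/

/-- A graph of group actions. The action at a vertex `v` is the permutation group `G v` on `X v`.
The actions at the arcs are indexed by the edges of the base graph, so that an arc and its reverse
carry the same action: the action at the arc `a` is `(H (edge a), Y (edge a))`. -/
structure GraphOfActions :
    Type (max (u₁ + 1) (u₂ + 1) (u₃ + 1) (u₄ + 1)) where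
  /-- the base graph -/
  Δ : SerreGraph.{u₁, u₂}
  connected : Δ.Connected
  X : Δ.V → Type u₃
  X_nonempty : ∀ v, Nonempty (X v)
  G : ∀ v, Subgroup (Equiv.Perm (X v))
  Y : Δ.E → Type u₄
  Y_nonempty : ∀ e, Nonempty (Y e)
  H : ∀ e, Subgroup (Equiv.Perm (Y e))
  /-- the embedding of the action at an arc into the action at its terminus -/
  Φ : ∀ a : Δ.A, Y (Δ.edge a) ↪ X (Δ.t a)
  Φ_embedding : ∀ a, ActionIso.IsEmbedding (H (Δ.edge a)) (G (Δ.t a)) (Φ a)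
  /-- the inversion agents of the self-reverse arcs -/
  agent : ∀ a : Δ.A, Δ.rev a = a → Equiv.Perm (Y (Δ.edge a))
  agent_conj : ∀ a ha, ∀ k : Equiv.Perm (Y (Δ.edge a)),
    agent a ha * k * (agent a ha)⁻¹ ∈ H (Δ.edge a) ↔ k ∈ H (Δ.edge a)
  agent_sq : ∀ a ha, agent a ha ^ 2 ∈ H (Δ.edge a)

namespace GraphOfActions

variable (𝒢 : GraphOfActions.{u₁, u₂, u₃, u₄})

/-- `a`-adhesion maps: the `G (t a)`-translates of `Φ a`. -/
def IsAdhesionMap (a : 𝒢.Δ.A) (Ψ : 𝒢.Y (𝒢.Δ.edge a) → 𝒢.X (𝒢.Δ.t a)) : Prop :=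
  ∃ γ ∈ 𝒢.G (𝒢.Δ.t a), ∀ y, Ψ y = γ (𝒢.Φ a y)

/-- Twisted adhesion maps of a self-reverse arc `a`: the `G (t a)`-translates of `Φ a ∘ h_a`,
where `h_a` is the inversion agent. -/
def IsTwistedAdhesionMap (a : 𝒢.Δ.A) (ha : 𝒢.Δ.rev a = a)
    (Ψ : 𝒢.Y (𝒢.Δ.edge a) → 𝒢.X (𝒢.Δ.t a)) : Prop :=
  ∃ γ ∈ 𝒢.G (𝒢.Δ.t a), ∀ y, Ψ y = γ (𝒢.Φ a (𝒢.agent a ha y))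

/-- `a`-adhesion sets: the `G (t a)`-translates of the image of `Φ a`. -/
def IsAdhesionSet (a : 𝒢.Δ.A) (S : Set (𝒢.X (𝒢.Δ.t a))) : Prop :=
  ∃ γ ∈ 𝒢.G (𝒢.Δ.t a), S = γ '' Set.range (𝒢.Φ a)

/-- A graph `Σ` with an equivalence relation on its vertices, a graph morphism `π` from the
quotient graph to the base graph, and a colouring `p` of the vertices and arcs with values in the
(disjoint) unions of the sets `X v` and of the sets `Y e`. -/
structure PreScaffolding where
  Γ : SerreGraph.{u₅, u₆}
  r : Setoid Γ.V
  π : SerreGraph.Hom (Γ.quotient r) 𝒢.Δ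
  pV : Γ.V → Σ v, 𝒢.X v
  pA : Γ.A → Σ e, 𝒢.Y e

namespace PreScaffolding

variable {𝒢} (S : 𝒢.PreScaffolding)

/-- The quotient graph `Σ/∼`. -/
abbrev T : SerreGraph := S.Γ.quotient S.r

/-- The class of a vertex `v` of `Σ`, as a vertex of `Σ/∼`. -/
def mkV (v : S.Γ.V) : S.T.V := Quotient.mk S.r v

/-- The class of an arc `a` of `Σ`, as an arc of `Σ/∼`. -/
def mkA (a : S.Γ.A) : S.T.A := Quotient.mk (S.Γ.arcSetoid S.r) a

/-- The vertex bundle of a vertex of `Σ/∼`. -/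
def vertexBundle (u : S.T.V) : Set S.Γ.V := {w | S.mkV w = u}

/-- The arc bundle of an arc of `Σ/∼`. -/
def arcBundle (e : S.T.A) : Set S.Γ.A := {b | S.mkA b = e}

/-- `Ψ` is the map `Ψ_e : Y(π e) → X(π (t e)) = X(t (π e))` with `Ψ (p b) = p (t b)` for every arc
`b` in the bundle of `e`. -/
def IsPsi (e : S.T.A)
    (Ψ : 𝒢.Y (𝒢.Δ.edge (S.π.onA e)) → 𝒢.X (𝒢.Δ.t (S.π.onA e))) : Prop :=
  ∀ b ∈ S.arcBundle e, ∀ y : 𝒢.Y (𝒢.Δ.edge (S.π.onA e)),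
    S.pA b = ⟨𝒢.Δ.edge (S.π.onA e), y⟩ → S.pV (S.Γ.t b) = ⟨𝒢.Δ.t (S.π.onA e), Ψ y⟩

/-- `Ψ_e` is a `π e`-adhesion map. -/
def PsiAdhesion (e : S.T.A) : Prop :=
  ∃ Ψ, S.IsPsi e Ψ ∧ 𝒢.IsAdhesionMap (S.π.onA e) Ψ

/-- `π e` is self-reverse and `Ψ_e` is a twisted `π e`-adhesion map. -/
def PsiTwisted (e : S.T.A) : Prop :=
  ∃ (he : 𝒢.Δ.rev (S.π.onA e) = S.π.onA e), ∃ Ψ, S.IsPsi e Ψ ∧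
    𝒢.IsTwistedAdhesionMap (S.π.onA e) he Ψ

end PreScaffolding

/-- A scaffolding `(Σ, ∼, π, p)` for a graph of group actions. -/
structure Scaffolding extends 𝒢.PreScaffolding where
  isTree : (Γ.quotient r).IsTree
  /-- there are no arcs inside a vertex bundle -/
  bundle_empty : ∀ b, ¬ r (Γ.o b) (Γ.t b)
  /-- `p` restricts to a bijection of every vertex bundle `[v]` onto `X(π [v])` -/
  pV_bij : ∀ u, Set.BijOn pV (toPreScaffolding.vertexBundle u) (Set.range (Sigma.mk (π.onV u)))
  /-- `p` restricts to a bijection of every arc bundle `[a]` onto `Y(π [a])` -/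
  pA_bij : ∀ e, Set.BijOn pA (toPreScaffolding.arcBundle e)
    (Set.range (Sigma.mk (𝒢.Δ.edge (π.onA e))))
  pA_rev : ∀ b, pA (Γ.rev b) = pA b
  psi_of_not_self_reverse : ∀ e, 𝒢.Δ.rev (π.onA e) ≠ π.onA e → toPreScaffolding.PsiAdhesion e
  psi_of_self_reverse : ∀ e, 𝒢.Δ.rev (π.onA e) = π.onA e →
    (toPreScaffolding.PsiAdhesion e ∧
      toPreScaffolding.PsiTwisted (toPreScaffolding.T.rev e)) ∨
    (toPreScaffolding.PsiTwisted e ∧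
      toPreScaffolding.PsiAdhesion (toPreScaffolding.T.rev e))
  /-- every `b`-adhesion set at `[v]` comes from exactly one arc `[a]` over `b` with terminus `[v]`;
  here `Ψ_[a] (p [a]) = p (t [a])` -/
  existsUnique_arc : ∀ (u : (Γ.quotient r).V) (b : 𝒢.Δ.A), 𝒢.Δ.t b = π.onV u →
    ∀ A : Set (𝒢.X (𝒢.Δ.t b)), 𝒢.IsAdhesionSet b A →
      ∃! e : (Γ.quotient r).A, π.onA e = b ∧ (Γ.quotient r).t e = u ∧
        (fun c => pV (Γ.t c)) '' toPreScaffolding.arcBundle e = Sigma.mk (𝒢.Δ.t b) '' A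

namespace Scaffolding

variable {𝒢} (S : 𝒢.Scaffolding)

/-- Scaffolding automorphisms: graph automorphisms that preserve `∼` (hence also the induced
relation on the arcs) and leave `π` invariant. -/
def IsScaffoldingAut (g : S.Γ.Aut) : Prop :=
  (∀ v w : S.Γ.V, S.r (g • v) (g • w) ↔ S.r v w) ∧
  (∀ v : S.Γ.V, S.π.onV (S.mkV (g • v)) = S.π.onV (S.mkV v)) ∧
  (∀ a : S.Γ.A, S.π.onA (S.mkA (g • a)) = S.π.onA (S.mkA a))

/-- `σ` is the local action of `g` at the vertex `u` of `Σ/∼`: `p (g w) = σ (p w)` for every `w` in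
the vertex bundle of `u`. -/
def IsLocalAction (g : S.Γ.Aut) (u : S.T.V) (σ : Equiv.Perm (𝒢.X (S.π.onV u))) : Prop :=
  ∀ w ∈ S.vertexBundle u, ∀ x : 𝒢.X (S.π.onV u),
    S.pV w = ⟨S.π.onV u, x⟩ → S.pV (g • w) = ⟨S.π.onV u, σ x⟩

/-- Acceptable: the local action at every vertex `u` of `Σ/∼` lies in `G (π u)`. -/
def IsAcceptable (g : S.Γ.Aut) : Prop :=
  ∀ u : S.T.V, ∃ σ ∈ 𝒢.G (S.π.onV u), S.IsLocalAction g u σ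

theorem IsAcceptable.exists_of_eq {S : 𝒢.Scaffolding} {g : S.Γ.Aut} (hg : S.IsAcceptable g)
    (u : S.T.V) {i : 𝒢.Δ.V} (hi : S.π.onV u = i) :
    ∃ σ ∈ 𝒢.G i, ∀ w ∈ S.vertexBundle u, ∀ x : 𝒢.X i,
      S.pV w = ⟨i, x⟩ → S.pV (g • w) = ⟨i, σ x⟩ := by
  subst hi
  exact hg u

/-- The universal group of a graph of group actions, as a group of automorphisms of a scaffolding:
all acceptable scaffolding automorphisms. -/
def universalGroup : Subgroup S.Γ.Aut where
  carrier := {g | S.IsScaffoldingAut g ∧ S.IsAcceptable g}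
  one_mem' := by
    refine ⟨⟨fun v w => by simp, fun v => by simp, fun a => by simp⟩, fun u => ?_⟩
    exact ⟨1, one_mem _, fun w _ x hx => by simpa using hx⟩
  mul_mem' := by
    rintro g h ⟨hg, hg'⟩ ⟨hh, hh'⟩
    refine ⟨⟨fun v w => ?_, fun v => ?_, fun a => ?_⟩, ?_⟩
    · rw [mul_smul, mul_smul, hg.1, hh.1]
    · rw [mul_smul, hg.2.1, hh.2.1]
    · rw [mul_smul, hg.2.2, hh.2.2]
    · rintro ⟨v⟩
      obtain ⟨σ, hσ, hσ'⟩ := hh' (S.mkV v)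
      obtain ⟨τ, hτ, hτ'⟩ := hg'.exists_of_eq (S.mkV (h • v)) (hh.2.1 v)
      refine ⟨τ * σ, mul_mem hτ hσ, fun w hw x hx => ?_⟩
      rw [mul_smul]
      refine hτ' (h • w) ?_ _ (hσ' w hw x hx)
      exact Quotient.sound ((hh.1 w v).2 (Quotient.exact hw))
  inv_mem' := by
    rintro g ⟨hg, hg'⟩
    have key : ∀ v : S.Γ.V, S.π.onV (S.mkV (g⁻¹ • v)) = S.π.onV (S.mkV v) := fun v => by
      rw [← hg.2.1 (g⁻¹ • v), smul_inv_smul]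
    have hr : ∀ v w : S.Γ.V, S.r (g⁻¹ • v) (g⁻¹ • w) ↔ S.r v w := fun v w => by
      rw [← hg.1 (g⁻¹ • v) (g⁻¹ • w), smul_inv_smul, smul_inv_smul]
    refine ⟨⟨hr, key, fun a => ?_⟩, ?_⟩
    · rw [← hg.2.2 (g⁻¹ • a), smul_inv_smul]
    · rintro ⟨v⟩
      obtain ⟨σ, hσ, hσ'⟩ := hg'.exists_of_eq (S.mkV (g⁻¹ • v)) (key v)
      refine ⟨σ⁻¹, inv_mem hσ, fun w hw x hx => ?_⟩
      have hw' : g⁻¹ • w ∈ S.vertexBundle (S.mkV (g⁻¹ • v)) :=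
        Quotient.sound ((hr w v).2 (Quotient.exact hw))
      obtain ⟨y, hy⟩ := (S.pV_bij _).mapsTo hw'
      have hsig : ∃ z : 𝒢.X (S.π.onV (S.mkV v)),
          S.pV (g⁻¹ • w) = ⟨S.π.onV (S.mkV v), z⟩ := by
        rw [← hy, ← key v]
        exact ⟨y, rfl⟩
      obtain ⟨z, hz⟩ := hsig
      have h1 := hσ' _ hw' z hz
      rw [smul_inv_smul] at h1
      have h2 : x = σ z := eq_of_heq (Sigma.mk.inj (hx.symm.trans h1)).2
      rw [hz, h2]
      exact congrArg (Sigma.mk _) (σ.symm_apply_apply z).symm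

end Scaffolding

end GraphOfActions

/-! Through the colouring `p`, an element of the universal group that preserves a vertex bundle acts
on it as an element of `G`. What needs proof is extension: every local isomorphism between two
vertex bundles, that is, a bijection which in colours is an element of `G`, comes from the universal
group (`IsLocalIso.exists_mem_universalGroup`).

A local isomorphism at the terminus of an arc `e` carries adhesion sets to adhesion sets, so
`existsUnique_arc` supplies an image arc `e'`, and the two arc bundles are matched by a permutation
`k` of the colours (`IsLocalIso.exists_arc`). Write `Ψ_e = γ ∘ Φ a ∘ ε` with `ε` either `1` or the
inversion agent, and `Ψ_e'` likewise with `ε'`. Then `k` is induced by a local isomorphism between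
the termini exactly when `ε' * k * ε⁻¹ ∈ H` (`IsTranslate.conj_mem`,
`IsTranslate.exists_isLocalIso`). This condition at `e` implies the one at the reverse arc because
the agent normalises `H` and has its square in `H`; hence the local isomorphism passes to the origin
(`IsLocalIso.exists_origin`).

Since paths in a tree are unique, these extensions can be chosen coherently
(`IsTree.exists_compatible_family`). The uniqueness in `existsUnique_arc` makes the resulting vertex
map of the tree bijective on neighbourhoods, hence bijective, and the glued map is an automorphism
because arcs are determined by their ends.

For arc bundles the criterion is applied with `e' = e`: as `ε` normalises `H`, the permutations
induced from the terminus are exactly those in `H`. -/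

/-! ### Trees -/

namespace SimpleGraph

variable {V W : Type*} {T : SimpleGraph V} {T' : SimpleGraph W}

/-- A graph morphism that is injective on neighbourhoods maps paths to paths if the target is
acyclic. -/
theorem IsAcyclic.isPath_map_of_injOn_neighborSet (hT' : T'.IsAcyclic) (f : T →g T')
    (hf : ∀ u, Set.InjOn f (T.neighborSet u)) {u v : V} (p : T.Walk u v) (hp : p.IsPath) :
    (p.map f).IsPath := by
  induction p with
  | nil => simp
  | @cons u w v h p ih =>
    rw [Walk.cons_isPath_iff] at hp
    have hq := ih hp.1
    rw [Walk.map_cons, Walk.cons_isPath_iff]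
    refine ⟨hq, fun hmem => ?_⟩
    -- In an acyclic graph, a neighbour of the start of a path that lies on the path is its second
    -- vertex. So a repetition forces `f` to identify two neighbours of `w`.
    have hs := hT'.eq_snd_of_adj_start hq (f.map_adj h).symm hmem
    cases p with
    | nil => exact (f.map_adj h).ne (by simpa using hs)
    | @cons _ x _ h' p' =>
      have hx : f u = f x := by simpa using hs
      have := hf w h.symm h' hx
      exact hp.2 (by simp [this])

/-- A graph morphism between trees that is injective on neighbourhoods is injective. -/
theorem IsTree.injective_of_injOn_neighborSet (hT : T.IsTree) (hT' : T'.IsAcyclic) (f : T →g T')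
    (hf : ∀ u, Set.InjOn f (T.neighborSet u)) : Function.Injective f := by
  intro u v huv
  obtain ⟨p, hp, -⟩ := hT.existsUnique_path u v
  have hq := hT'.isPath_map_of_injOn_neighborSet f hf p hp
  have hq' : ((p.map f).copy rfl huv.symm).IsPath := (Walk.isPath_copy _ _ _).2 hq
  have hlen := Walk.length_eq_zero_iff.2 (Walk.isPath_iff_nil.1 hq')
  rw [Walk.length_copy, Walk.length_map] at hlen
  exact Walk.eq_of_length_eq_zero hlen

/-- A map to a connected graph is surjective if its range is nonempty and closed under taking
neighbours. -/
theorem Connected.surjective_of_neighbor_mem_range (hT' : T'.Connected) [Nonempty V] (f : V → W)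
    (hf : ∀ u w, T'.Adj (f u) w → w ∈ Set.range f) : Function.Surjective f := by
  intro w
  obtain ⟨u⟩ := ‹Nonempty V›
  obtain ⟨p⟩ := hT'.preconnected w (f u)
  have key : ∀ {a b : W} (_ : T'.Walk a b), b ∈ Set.range f → a ∈ Set.range f := by
    intro a b p
    induction p with
    | nil => exact id
    | cons h p ih =>
      intro hb
      obtain ⟨x, rfl⟩ := ih hb
      exact hf x _ h.symm
  exact key p ⟨u, rfl⟩

/-- Data at a walk, obtained from data at its end by successive extension along its arcs. -/
noncomputable def Walk.transport {M : V → Type*} (next : ∀ u w, T.Adj u w → M w → M u) {r : V}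
    (m : M r) : ∀ {u : V}, T.Walk u r → M u
  | _, .nil => m
  | _, .cons h p => next _ _ h (p.transport next m)

/-- Local data on a tree that can be extended from a vertex to its neighbours can be extended to
the whole tree. -/
theorem IsTree.exists_compatible_family (hT : T.IsTree) {M : V → Type*}
    (R : ∀ u w, M u → M w → Prop) (hsymm : ∀ u w m n, R u w m n → R w u n m)
    (hext : ∀ u w, T.Adj u w → ∀ m : M u, ∃ n : M w, R u w m n) (r : V) (m₀ : M r) :
    ∃ m : ∀ u, M u, m r = m₀ ∧ ∀ u w, T.Adj u w → R u w (m u) (m w) := by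
  choose next hnext using hext
  choose path hpath huniq using fun u => hT.existsUnique_path u r
  let next' : ∀ u w, T.Adj u w → M w → M u := fun u w h => next w u h.symm
  let m : ∀ u, M u := fun u => (path u).transport next' m₀
  -- If `u` is off the path from `w` to the root, then the path from `u` is that path preceded by
  -- one edge, and `m u` was by definition obtained from `m w`. For any edge this holds in one of
  -- its two directions.
  have hcons : ∀ u w (h : T.Adj u w), u ∉ (path w).support → R u w (m u) (m w) := by
    intro u w h hu
    have : path u = Walk.cons h (path w) :=
      (huniq u _ ((Walk.cons_isPath_iff _ _).2 ⟨hpath w, hu⟩)).symm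
    have hm : m u = next w u h.symm (m w) := by
      simp only [m, this, Walk.transport, next']
    rw [hm]
    exact hsymm _ _ _ _ (hnext _ _ _ _)
  refine ⟨m, ?_, fun u w h => ?_⟩
  · have : path r = Walk.nil := (huniq r _ Walk.IsPath.nil).symm
    simp only [m, this, Walk.transport]
  · by_cases hu : u ∈ (path w).support
    · refine hsymm _ _ _ _ (hcons w u h.symm fun hw => ?_)
      exact hT.isAcyclic.ne_mem_support_of_support_of_adj_of_isPath (hpath w).reverse
        (hpath u).reverse h.symm (by simpa using hu) (by simpa using hw)
    · exact hcons u w h hu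

end SimpleGraph

/-! ### Permutation group actions -/

namespace ActionIso

-- As `k` is a permutation of `Y`, agreement with `g` on `Y` already forces `g • Y = Y`; no separate
-- stabiliser condition is needed.
open scoped Pointwise in
theorem mem_induced_iff {G Ω : Type*} [Group G] [MulAction G Ω] {Y : Set Ω}
    {k : Equiv.Perm Y} :
    k ∈ induced G Y ↔ ∃ g : G, ∀ y : Y, (k y : Ω) = g • (y : Ω) := by
  constructor
  · rintro ⟨g, rfl⟩
    exact ⟨g.1, fun y => rfl⟩
  · rintro ⟨g, h⟩
    have hg : g • Y = Y := by
      ext y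
      constructor
      · rintro ⟨y, hy, rfl⟩
        change g • y ∈ Y
        rw [← h ⟨y, hy⟩]
        exact (k ⟨y, hy⟩).2
      · intro hy
        refine ⟨k.symm ⟨y, hy⟩, (k.symm ⟨y, hy⟩).2, ?_⟩
        change g • _ = _
        rw [← h, k.apply_symm_apply]
    exact ⟨⟨g, hg⟩, Equiv.ext fun y => Subtype.ext (h y).symm⟩

/-- Permutation groups that are conjugate under a bijection are isomorphic. -/
theorem isomorphic_of_permCongr {X Y : Type*} {K : Subgroup (Equiv.Perm Y)}
    {L : Subgroup (Equiv.Perm X)} (e : Y ≃ X)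
    (h : ∀ k : Equiv.Perm Y, k ∈ K ↔ e.permCongr k ∈ L) : Isomorphic K Y L X := by
  have hmap : K.map e.permCongrHom.toMonoidHom = L := by
    ext l
    constructor
    · rintro ⟨k, hk, rfl⟩
      exact (h k).1 hk
    · intro hl
      refine ⟨e.permCongr.symm l, (h _).2 ?_, e.permCongr.apply_symm_apply l⟩
      rwa [e.permCongr.apply_symm_apply]
  refine ⟨(e.permCongrHom.subgroupMap K).trans (MulEquiv.subgroupCongr hmap), e, fun k y => ?_⟩
  change e (k.1 (e.symm (e y))) = e (k.1 y)
  simp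

variable {X Y : Type*} {H : Subgroup (Equiv.Perm Y)} {G : Subgroup (Equiv.Perm X)} {Φ : Y ↪ X}

theorem IsEmbedding.exists_extension (hΦ : IsEmbedding H G Φ) {k : Equiv.Perm Y} (hk : k ∈ H) :
    ∃ σ ∈ G, ∀ y, σ (Φ y) = Φ (k y) := by
  obtain ⟨φ, hφ⟩ := hΦ
  obtain ⟨g, hg⟩ := mem_induced_iff.1 (φ ⟨k, hk⟩).2
  exact ⟨g.1, g.2, fun y => (hg ⟨Φ y, Set.mem_range_self y⟩).symm.trans (hφ ⟨k, hk⟩ y)⟩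

/-- Transported to the image of `Φ`, the permutation `k` lies in the induced group, and its preimage
under `φ` acts as `k` because `Φ` is injective. Together with `exists_extension`, `H` consists
exactly of the permutations that extend along `Φ` to elements of `G`. -/
theorem IsEmbedding.mem_of_extension (hΦ : IsEmbedding H G Φ) {k : Equiv.Perm Y}
    {σ : Equiv.Perm X} (hσ : σ ∈ G) (h : ∀ y, σ (Φ y) = Φ (k y)) : k ∈ H := by
  obtain ⟨φ, hφ⟩ := hΦ
  let e := Equiv.ofInjective Φ Φ.injective
  have hτ : e.permCongr k ∈ induced G (Set.range Φ) := by
    refine mem_induced_iff.2 ⟨⟨σ, hσ⟩, fun x => ?_⟩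
    obtain ⟨y, rfl⟩ := e.surjective x
    rw [Equiv.permCongr_apply, e.symm_apply_apply]
    exact (h y).symm
  have hk : ((φ.symm ⟨_, hτ⟩ : H) : Equiv.Perm Y) = k := by
    ext y
    apply Φ.injective
    rw [← hφ (φ.symm ⟨_, hτ⟩) y, φ.apply_symm_apply]
    change (e (k (e.symm (e y))) : X) = Φ (k y)
    rw [e.symm_apply_apply]
    rfl
  rw [← hk]
  exact (φ.symm ⟨_, hτ⟩).2

end ActionIso

theorem Function.Injective.exists_perm_comp_eq {X Y : Type*} {f g : Y → X}
    (hf : Function.Injective f) (hg : Function.Injective g) (h : Set.range f = Set.range g) :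
    ∃ k : Equiv.Perm Y, ∀ y, f (k y) = g y := by
  refine ⟨(Equiv.ofInjective g hg).trans
    ((Equiv.setCongr h.symm).trans (Equiv.ofInjective f hf).symm), fun y => ?_⟩
  exact Equiv.apply_ofInjective_symm hf _

namespace GraphOfActions.Scaffolding

variable {𝒢 : GraphOfActions.{u₁, u₂, u₃, u₄}} (S : Scaffolding.{u₁, u₂, u₃, u₄, u₅, u₆} 𝒢)

/-! ### Coordinates on bundles -/

/-- The index `i` is a free variable so that bundles over the same vertex of `Δ` can be coloured by
one type without casts. -/
theorem exists_pV {u : S.T.V} {i : 𝒢.Δ.V} (hi : S.π.onV u = i) {w : S.Γ.V} (hw : S.mkV w = u) :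
    ∃ x, S.pV w = ⟨i, x⟩ := by
  subst hi
  obtain ⟨x, hx⟩ := (S.pV_bij u).mapsTo hw
  exact ⟨x, hx.symm⟩

theorem exists_of_pV {u : S.T.V} {i : 𝒢.Δ.V} (hi : S.π.onV u = i) (x : 𝒢.X i) :
    ∃ w, S.mkV w = u ∧ S.pV w = ⟨i, x⟩ := by
  subst hi
  obtain ⟨w, hw, hx⟩ := (S.pV_bij u).surjOn ⟨x, rfl⟩
  exact ⟨w, hw, hx⟩

theorem eq_of_pV_eq {w w' : S.Γ.V} (h : S.mkV w = S.mkV w') (hp : S.pV w = S.pV w') : w = w' :=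
  (S.pV_bij (S.mkV w')).injOn h rfl hp

theorem exists_pA {e : S.T.A} {i : 𝒢.Δ.E} (hi : 𝒢.Δ.edge (S.π.onA e) = i) {b : S.Γ.A}
    (hb : S.mkA b = e) : ∃ y, S.pA b = ⟨i, y⟩ := by
  subst hi
  obtain ⟨x, hx⟩ := (S.pA_bij e).mapsTo hb
  exact ⟨x, hx.symm⟩

theorem exists_of_pA {e : S.T.A} {i : 𝒢.Δ.E} (hi : 𝒢.Δ.edge (S.π.onA e) = i) (y : 𝒢.Y i) :
    ∃ b, S.mkA b = e ∧ S.pA b = ⟨i, y⟩ := by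
  subst hi
  obtain ⟨b, hb, hy⟩ := (S.pA_bij e).surjOn ⟨y, rfl⟩
  exact ⟨b, hb, hy⟩

theorem eq_of_pA_eq {b b' : S.Γ.A} (h : S.mkA b = S.mkA b') (hp : S.pA b = S.pA b') : b = b' :=
  (S.pA_bij (S.mkA b')).injOn h rfl hp

theorem t_mkA (b : S.Γ.A) : S.T.t (S.mkA b) = S.mkV (S.Γ.t b) := rfl

theorem o_mkA (b : S.Γ.A) : S.T.o (S.mkA b) = S.mkV (S.Γ.o b) := rfl

theorem rev_mkA (b : S.Γ.A) : S.T.rev (S.mkA b) = S.mkA (S.Γ.rev b) := rfl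

theorem mkV_t {b : S.Γ.A} {e : S.T.A} (h : S.mkA b = e) : S.mkV (S.Γ.t b) = S.T.t e := by
  rw [← h, t_mkA]

theorem mkA_rev {b : S.Γ.A} {e : S.T.A} (h : S.mkA b = e) :
    S.mkA (S.Γ.rev b) = S.T.rev e := by
  rw [← h, rev_mkA]

theorem arc_ext {e e' : S.T.A} (ho : S.T.o e = S.T.o e') (ht : S.T.t e = S.T.t e') : e = e' :=
  S.isTree.1.2 (Prod.ext ho ht)

theorem pi_t {e : S.T.A} {a : 𝒢.Δ.A} (ha : S.π.onA e = a) : S.π.onV (S.T.t e) = 𝒢.Δ.t a := by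
  rw [← ha, S.π.map_t]

theorem pi_rev {e : S.T.A} {a : 𝒢.Δ.A} (ha : S.π.onA e = a) :
    S.π.onA (S.T.rev e) = 𝒢.Δ.rev a := by
  rw [← ha, S.π.map_rev]

theorem _root_.SerreGraph.edge_rev (Γ : SerreGraph) (a : Γ.A) : Γ.edge (Γ.rev a) = Γ.edge a :=
  Quotient.sound (Or.inr (Γ.rev_rev a).symm)

/-! ### Adhesion maps of a scaffolding -/

/-- The map `Ψ_e` from the bundle of `e` to the bundle of its terminus is a translate of
`Φ a ∘ ε`. -/
def IsTranslate (e : S.T.A) (a : 𝒢.Δ.A) (ε : Equiv.Perm (𝒢.Y (𝒢.Δ.edge a))) : Prop :=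
  ∃ γ ∈ 𝒢.G (𝒢.Δ.t a), ∀ b, S.mkA b = e → ∀ y, S.pA b = ⟨𝒢.Δ.edge a, y⟩ →
    S.pV (S.Γ.t b) = ⟨𝒢.Δ.t a, γ (𝒢.Φ a (ε y))⟩

theorem isTranslate_one_of_psiAdhesion {e : S.T.A} {a : 𝒢.Δ.A} (ha : S.π.onA e = a)
    (h : S.PsiAdhesion e) : S.IsTranslate e a 1 := by
  subst ha
  obtain ⟨Ψ, hΨ, γ, hγ, hΨγ⟩ := h
  refine ⟨γ, hγ, fun b hb y hy => ?_⟩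
  rw [hΨ b hb y hy, hΨγ]
  rfl

theorem isTranslate_agent_of_psiTwisted {e : S.T.A} {a : 𝒢.Δ.A} (ha : S.π.onA e = a)
    (hr : 𝒢.Δ.rev a = a) (h : S.PsiTwisted e) : S.IsTranslate e a (𝒢.agent a hr) := by
  subst ha
  obtain ⟨_, Ψ, hΨ, γ, hγ, hΨγ⟩ := h
  refine ⟨γ, hγ, fun b hb y hy => ?_⟩
  rw [hΨ b hb y hy, hΨγ]

theorem isTranslate_of_not_self_reverse {e : S.T.A} {a : 𝒢.Δ.A} (ha : S.π.onA e = a)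
    (hr : 𝒢.Δ.rev a ≠ a) : S.IsTranslate e a 1 := by
  refine S.isTranslate_one_of_psiAdhesion ha (S.psi_of_not_self_reverse e ?_)
  rwa [ha]

theorem isTranslate_of_self_reverse {e : S.T.A} {a : 𝒢.Δ.A} (ha : S.π.onA e = a)
    (hr : 𝒢.Δ.rev a = a) :
    (S.IsTranslate e a 1 ∧ S.IsTranslate (S.T.rev e) a (𝒢.agent a hr)) ∨
      (S.IsTranslate e a (𝒢.agent a hr) ∧ S.IsTranslate (S.T.rev e) a 1) := by
  have ha' : S.π.onA (S.T.rev e) = a := (S.pi_rev ha).trans hr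
  rcases S.psi_of_self_reverse e (by rw [ha, hr]) with ⟨h, h'⟩ | ⟨h, h'⟩
  · exact Or.inl ⟨S.isTranslate_one_of_psiAdhesion ha h,
      S.isTranslate_agent_of_psiTwisted ha' hr h'⟩
  · exact Or.inr ⟨S.isTranslate_agent_of_psiTwisted ha hr h,
      S.isTranslate_one_of_psiAdhesion ha' h'⟩

/-- `Ψ_e` is a translate of `Φ a ∘ ε` for some `ε` that normalises `H a`. -/
theorem exists_isTranslate {e : S.T.A} {a : 𝒢.Δ.A} (ha : S.π.onA e = a) :
    ∃ ε, S.IsTranslate e a ε ∧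
      ∀ k, ε * k * ε⁻¹ ∈ 𝒢.H (𝒢.Δ.edge a) ↔ k ∈ 𝒢.H (𝒢.Δ.edge a) := by
  by_cases hr : 𝒢.Δ.rev a = a
  · rcases S.isTranslate_of_self_reverse ha hr with ⟨h, -⟩ | ⟨h, -⟩
    · exact ⟨1, h, fun k => by simp⟩
    · exact ⟨_, h, 𝒢.agent_conj a hr⟩
  · exact ⟨1, S.isTranslate_of_not_self_reverse ha hr, fun k => by simp⟩

/-- `Ψ_e` is injective, being a composite of `Φ a` with permutations, so the terminus determines the
colour of an arc within its bundle. -/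
theorem arc_eq_of_t_eq {b b' : S.Γ.A} (h : S.mkA b = S.mkA b') (ht : S.Γ.t b = S.Γ.t b') :
    b = b' := by
  obtain ⟨ε, ⟨γ, -, hγ⟩, -⟩ := S.exists_isTranslate (e := S.mkA b') rfl
  obtain ⟨y, hy⟩ := S.exists_pA rfl h
  obtain ⟨y', hy'⟩ := S.exists_pA rfl (rfl : S.mkA b' = S.mkA b')
  have h1 := hγ b h y hy
  rw [ht, hγ b' rfl y' hy'] at h1
  have h2 : y' = y := by
    simpa using eq_of_heq (Sigma.mk.inj h1).2
  exact S.eq_of_pA_eq h (by rw [hy, hy', h2])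

/-- The arcs of a scaffolding are determined by their ends. -/
theorem arc_eq_of_ends_eq {b b' : S.Γ.A} (ho : S.Γ.o b = S.Γ.o b') (ht : S.Γ.t b = S.Γ.t b') :
    b = b' := by
  refine S.arc_eq_of_t_eq (S.arc_ext ?_ ?_) ht
  · rw [o_mkA, o_mkA, ho]
  · rw [t_mkA, t_mkA, ht]

/-! ### Local isomorphisms -/

/-- `f` maps the bundle of `u` to the bundle of `u'` and acts there as the permutation `σ`. -/
def ActsAs (u u' : S.T.V) (f : S.Γ.V → S.Γ.V) (i : 𝒢.Δ.V) (σ : Equiv.Perm (𝒢.X i)) : Prop :=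
  ∀ w, S.mkV w = u → S.mkV (f w) = u' ∧ ∀ x, S.pV w = ⟨i, x⟩ → S.pV (f w) = ⟨i, σ x⟩

/-- `f` maps the bundle of `u` to the bundle of `u'` and acts there as an element of the group
`G (π u)`. -/
def IsLocalIso (u u' : S.T.V) (f : S.Γ.V → S.Γ.V) : Prop :=
  ∃ i, S.π.onV u = i ∧ S.π.onV u' = i ∧ ∃ σ ∈ 𝒢.G i, S.ActsAs u u' f i σ

theorem exists_actsAs {u u' : S.T.V} {i : 𝒢.Δ.V} (hu : S.π.onV u = i) (hu' : S.π.onV u' = i)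
    (σ : Equiv.Perm (𝒢.X i)) : ∃ f, S.ActsAs u u' f i σ := by
  have : ∀ w, ∃ w', S.mkV w = u →
      S.mkV w' = u' ∧ ∀ x, S.pV w = ⟨i, x⟩ → S.pV w' = ⟨i, σ x⟩ := by
    intro w
    by_cases hw : S.mkV w = u
    · obtain ⟨x, hx⟩ := S.exists_pV hu hw
      obtain ⟨w', hw', hx'⟩ := S.exists_of_pV hu' (σ x)
      refine ⟨w', fun _ => ⟨hw', fun x₁ hx₁ => ?_⟩⟩
      have : x = x₁ := eq_of_heq (Sigma.mk.inj (hx.symm.trans hx₁)).2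
      rw [hx', this]
    -- Off the bundle of `u` the value of `f` is irrelevant.
    · exact ⟨w, fun h => absurd h hw⟩
  choose f hf using this
  exact ⟨f, hf⟩

variable {S}

theorem ActsAs.injOn {u u' : S.T.V} {f : S.Γ.V → S.Γ.V} {i : 𝒢.Δ.V} {σ : Equiv.Perm (𝒢.X i)}
    (h : S.ActsAs u u' f i σ) (hu : S.π.onV u = i) {w w' : S.Γ.V} (hw : S.mkV w = u)
    (hw' : S.mkV w' = u) (hf : f w = f w') : w = w' := by
  obtain ⟨x, hx⟩ := S.exists_pV hu hw
  obtain ⟨x', hx'⟩ := S.exists_pV hu hw'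
  have h1 := (h w hw).2 x hx
  rw [hf, (h w' hw').2 x' hx'] at h1
  have h2 : x' = x := σ.injective (eq_of_heq (Sigma.mk.inj h1).2)
  exact S.eq_of_pV_eq (hw.trans hw'.symm) (by rw [hx, hx', h2])

theorem IsLocalIso.injOn {u u' : S.T.V} {f : S.Γ.V → S.Γ.V} (h : S.IsLocalIso u u' f)
    {w w' : S.Γ.V} (hw : S.mkV w = u) (hw' : S.mkV w' = u) (hf : f w = f w') : w = w' := by
  obtain ⟨i, hu, -, σ, -, hσ⟩ := h
  exact hσ.injOn hu hw hw' hf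

theorem IsLocalIso.surjOn {u u' : S.T.V} {f : S.Γ.V → S.Γ.V} (h : S.IsLocalIso u u' f)
    {w' : S.Γ.V} (hw' : S.mkV w' = u') : ∃ w, S.mkV w = u ∧ f w = w' := by
  obtain ⟨i, hu, hu', σ, -, hσ⟩ := h
  obtain ⟨x', hx'⟩ := S.exists_pV hu' hw'
  obtain ⟨w, hw, hx⟩ := S.exists_of_pV hu (σ.symm x')
  refine ⟨w, hw, S.eq_of_pV_eq ((hσ w hw).1.trans hw'.symm) ?_⟩
  rw [(hσ w hw).2 _ hx, hx', σ.apply_symm_apply]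

theorem IsLocalIso.mapsTo {u u' : S.T.V} {f : S.Γ.V → S.Γ.V} (h : S.IsLocalIso u u' f)
    {w : S.Γ.V} (hw : S.mkV w = u) : S.mkV (f w) = u' := by
  obtain ⟨i, -, -, σ, -, hσ⟩ := h
  exact (hσ w hw).1

theorem IsLocalIso.pi_eq {u u' : S.T.V} {f : S.Γ.V → S.Γ.V} (h : S.IsLocalIso u u' f) :
    S.π.onV u' = S.π.onV u := by
  obtain ⟨i, hu, hu', -⟩ := h
  rw [hu, hu']

theorem IsLocalIso.exists_actsAs {u u' : S.T.V} {f : S.Γ.V → S.Γ.V} (h : S.IsLocalIso u u' f)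
    {i : 𝒢.Δ.V} (hi : S.π.onV u = i) : ∃ σ ∈ 𝒢.G i, S.ActsAs u u' f i σ := by
  obtain ⟨j, hj, -, hσ⟩ := h
  obtain rfl : j = i := hj.symm.trans hi
  exact hσ

end GraphOfActions.Scaffolding

namespace GraphOfActions.Scaffolding

variable {𝒢 : GraphOfActions.{u₁, u₂, u₃, u₄}} {S : Scaffolding.{u₁, u₂, u₃, u₄, u₅, u₆} 𝒢}

/-! ### Extending local isomorphisms along an arc -/

variable (S) in
/-- The arc `b` of the bundle of `e` corresponds to the arc `b'` of the bundle of `e'` under the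
permutation `k` of the colours. -/
def ArcRel (e e' : S.T.A) {i : 𝒢.Δ.E} (k : Equiv.Perm (𝒢.Y i)) (b b' : S.Γ.A) : Prop :=
  S.mkA b = e ∧ S.mkA b' = e' ∧ ∃ y, S.pA b = ⟨i, y⟩ ∧ S.pA b' = ⟨i, k y⟩

theorem ArcRel.rev {e e' : S.T.A} {i : 𝒢.Δ.E} {k : Equiv.Perm (𝒢.Y i)} {b b' : S.Γ.A}
    (h : S.ArcRel e e' k b b') :
    S.ArcRel (S.T.rev e) (S.T.rev e') k (S.Γ.rev b) (S.Γ.rev b') := by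
  obtain ⟨hb, hb', y, hy, hy'⟩ := h
  exact ⟨S.mkA_rev hb, S.mkA_rev hb', y, (S.pA_rev b).trans hy, (S.pA_rev b').trans hy'⟩

theorem exists_arcRel_right {e e' : S.T.A} {i : 𝒢.Δ.E} (hi : 𝒢.Δ.edge (S.π.onA e) = i)
    (hi' : 𝒢.Δ.edge (S.π.onA e') = i) (k : Equiv.Perm (𝒢.Y i)) {b : S.Γ.A}
    (hb : S.mkA b = e) : ∃ b', S.ArcRel e e' k b b' := by
  obtain ⟨y, hy⟩ := S.exists_pA hi hb
  obtain ⟨b', hb', hy'⟩ := S.exists_of_pA hi' (k y)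
  exact ⟨b', hb, hb', y, hy, hy'⟩

theorem exists_arcRel_left {e e' : S.T.A} {i : 𝒢.Δ.E} (hi : 𝒢.Δ.edge (S.π.onA e) = i)
    (hi' : 𝒢.Δ.edge (S.π.onA e') = i) (k : Equiv.Perm (𝒢.Y i)) {b' : S.Γ.A}
    (hb' : S.mkA b' = e') : ∃ b, S.ArcRel e e' k b b' := by
  obtain ⟨y, hy⟩ := S.exists_pA hi' hb'
  obtain ⟨b, hb, hy'⟩ := S.exists_of_pA hi (k.symm y)
  exact ⟨b, hb, hb', _, hy', by rw [hy, k.apply_symm_apply]⟩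

/-- On the image of `Φ a`, the element `γ'⁻¹ * σ * γ` of `G` acts as `ε' * k * ε⁻¹`, which therefore
lies in `H`. -/
theorem IsTranslate.conj_mem {e e' : S.T.A} {a : 𝒢.Δ.A} (ha : S.π.onA e = a)
    (ha' : S.π.onA e' = a) {ε ε' k : Equiv.Perm (𝒢.Y (𝒢.Δ.edge a))} (hε : S.IsTranslate e a ε)
    (hε' : S.IsTranslate e' a ε') {f : S.Γ.V → S.Γ.V} (hf : S.IsLocalIso (S.T.t e) (S.T.t e') f)
    (hk : ∀ b b', S.ArcRel e e' k b b' → f (S.Γ.t b) = S.Γ.t b') :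
    ε' * k * ε⁻¹ ∈ 𝒢.H (𝒢.Δ.edge a) := by
  obtain ⟨γ, hγ, hγe⟩ := hε
  obtain ⟨γ', hγ', hγe'⟩ := hε'
  obtain ⟨σ, hσ, hσf⟩ := hf.exists_actsAs (S.pi_t ha)
  refine (𝒢.Φ_embedding a).mem_of_extension (mul_mem (mul_mem (inv_mem hγ') hσ) hγ) fun z => ?_
  obtain ⟨y, rfl⟩ := ε.surjective z
  obtain ⟨b, hb, hy⟩ := S.exists_of_pA (congrArg _ ha) y
  obtain ⟨b', hb', hy'⟩ := S.exists_of_pA (congrArg _ ha') (k y)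
  have h1 := (hσf _ (S.mkV_t hb)).2 _ (hγe b hb y hy)
  rw [hk b b' ⟨hb, hb', y, hy, hy'⟩, hγe' b' hb' _ hy'] at h1
  have h2 := eq_of_heq (Sigma.mk.inj h1).2
  change γ'.symm (σ (γ (𝒢.Φ a (ε y)))) = 𝒢.Φ a (ε' (k (ε.symm (ε y))))
  rw [ε.symm_apply_apply, Equiv.symm_apply_eq, h2]

/-- Converse of `conj_mem`: if `σ ∈ G` extends `ε' * k * ε⁻¹` along `Φ a`, then `γ' * σ * γ⁻¹` is
the required local action. -/
theorem IsTranslate.exists_isLocalIso {e e' : S.T.A} {a : 𝒢.Δ.A} (ha : S.π.onA e = a)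
    (ha' : S.π.onA e' = a) {ε ε' k : Equiv.Perm (𝒢.Y (𝒢.Δ.edge a))} (hε : S.IsTranslate e a ε)
    (hε' : S.IsTranslate e' a ε') (hk : ε' * k * ε⁻¹ ∈ 𝒢.H (𝒢.Δ.edge a)) :
    ∃ f, S.IsLocalIso (S.T.t e) (S.T.t e') f ∧
      ∀ b b', S.ArcRel e e' k b b' → f (S.Γ.t b) = S.Γ.t b' := by
  obtain ⟨γ, hγ, hγe⟩ := hε
  obtain ⟨γ', hγ', hγe'⟩ := hε'
  obtain ⟨σ, hσ, hσk⟩ := (𝒢.Φ_embedding a).exists_extension hk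
  obtain ⟨f, hf⟩ := S.exists_actsAs (S.pi_t ha) (S.pi_t ha') (γ' * σ * γ⁻¹)
  refine ⟨f, ⟨_, S.pi_t ha, S.pi_t ha', _, mul_mem (mul_mem hγ' hσ) (inv_mem hγ), hf⟩, ?_⟩
  rintro b b' ⟨hb, hb', y, hy, hy'⟩
  refine S.eq_of_pV_eq ((hf _ (S.mkV_t hb)).1.trans (S.mkV_t hb').symm) ?_
  rw [(hf _ (S.mkV_t hb)).2 _ (hγe b hb y hy), hγe' b' hb' _ hy']
  have h1 := hσk (ε y)
  change _ = 𝒢.Φ a (ε' (k (ε.symm (ε y)))) at h1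
  rw [ε.symm_apply_apply] at h1
  change (⟨_, γ' (σ (γ.symm (γ (𝒢.Φ a (ε y)))))⟩ : Σ v, 𝒢.X v) = _
  rw [γ.symm_apply_apply, h1]

/-- A local isomorphism at the terminus of an arc that induces an arc bundle bijection extends to
the origin of the arc. -/
theorem IsLocalIso.exists_origin {e e' : S.T.A} {a : 𝒢.Δ.A} (ha : S.π.onA e = a)
    (ha' : S.π.onA e' = a) {k : Equiv.Perm (𝒢.Y (𝒢.Δ.edge a))}
    {f : S.Γ.V → S.Γ.V} (hf : S.IsLocalIso (S.T.t e) (S.T.t e') f)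
    (hk : ∀ b b', S.ArcRel e e' k b b' → f (S.Γ.t b) = S.Γ.t b') :
    ∃ f', S.IsLocalIso (S.T.o e) (S.T.o e') f' ∧
      ∀ b b', S.ArcRel e e' k b b' → f' (S.Γ.o b) = S.Γ.o b' := by
  suffices h : ∃ f', S.IsLocalIso (S.T.t (S.T.rev e)) (S.T.t (S.T.rev e')) f' ∧
      ∀ b b', S.ArcRel (S.T.rev e) (S.T.rev e') k b b' → f' (S.Γ.t b) = S.Γ.t b' by
    obtain ⟨f', hf', h⟩ := h
    refine ⟨f', by rwa [S.T.o_eq, S.T.o_eq], fun b b' hb => ?_⟩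
    rw [S.Γ.o_eq, S.Γ.o_eq, h _ _ hb.rev]
  by_cases hr : 𝒢.Δ.rev a = a
  · have hra := (S.pi_rev ha).trans hr
    have hra' := (S.pi_rev ha').trans hr
    set η := 𝒢.agent a hr with hη
    have hconj := 𝒢.agent_conj a hr
    have hsq := 𝒢.agent_sq a hr
    rw [← hη] at hconj hsq
    -- Passing to the reverse arcs swaps `1` and `η` in both `ε` and `ε'`. If `ε = ε'`, conjugation
    -- by `η` suffices; in the mixed cases `η * k` and `k * η⁻¹` have to be exchanged, which also
    -- uses `η ^ 2 ∈ H`.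
    rcases S.isTranslate_of_self_reverse ha hr with ⟨h, h'⟩ | ⟨h, h'⟩ <;>
      rcases S.isTranslate_of_self_reverse ha' hr with ⟨g, g'⟩ | ⟨g, g'⟩ <;>
      refine h'.exists_isLocalIso hra hra' g' ?_ <;>
      have hmem := h.conj_mem ha ha' g hf hk <;>
      rw [← hη] at *
    · exact (hconj k).2 (by simpa using hmem)
    · have := mul_mem hmem (inv_mem hsq)
      have h2 := (hconj (η⁻¹ * (η * k * 1⁻¹ * (η ^ 2)⁻¹) * η)).1 (by
        convert this using 1; group)
      convert h2 using 1
      group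
    · have h2 := (hconj _).2 hmem
      have := mul_mem h2 hsq
      convert this using 1
      group
    · simpa using (hconj k).1 hmem
  · have hrr : 𝒢.Δ.rev (𝒢.Δ.rev a) ≠ 𝒢.Δ.rev a := by
      rw [𝒢.Δ.rev_rev]
      exact fun h => hr h.symm
    have hmem : k ∈ 𝒢.H (𝒢.Δ.edge a) := by
      simpa using (S.isTranslate_of_not_self_reverse ha hr).conj_mem ha ha'
        (S.isTranslate_of_not_self_reverse ha' hr) hf hk
    -- The edges of `a` and of its reverse are equal only propositionally, so the index is
    -- generalised before `k` is used at the reverse arc.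
    have key : ∀ (i : 𝒢.Δ.E) (_ : 𝒢.Δ.edge (𝒢.Δ.rev a) = i) (k : Equiv.Perm (𝒢.Y i)),
        k ∈ 𝒢.H i → ∃ f', S.IsLocalIso (S.T.t (S.T.rev e)) (S.T.t (S.T.rev e')) f' ∧
          ∀ b b', S.ArcRel (S.T.rev e) (S.T.rev e') k b b' → f' (S.Γ.t b) = S.Γ.t b' := by
      rintro i rfl k hk
      exact (S.isTranslate_of_not_self_reverse (S.pi_rev ha) hrr).exists_isLocalIso (S.pi_rev ha)
        (S.pi_rev ha') (S.isTranslate_of_not_self_reverse (S.pi_rev ha') hrr) (by simpa using hk)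
    exact key _ (𝒢.Δ.edge_rev a) k hmem

/-! ### The arcs at a vertex -/

theorem IsTranslate.image_arcBundle {e : S.T.A} {a : 𝒢.Δ.A} (ha : S.π.onA e = a)
    {ε : Equiv.Perm (𝒢.Y (𝒢.Δ.edge a))} {γ : Equiv.Perm (𝒢.X (𝒢.Δ.t a))}
    (h : ∀ b, S.mkA b = e → ∀ y, S.pA b = ⟨𝒢.Δ.edge a, y⟩ →
      S.pV (S.Γ.t b) = ⟨𝒢.Δ.t a, γ (𝒢.Φ a (ε y))⟩) :
    (fun c => S.pV (S.Γ.t c)) '' S.arcBundle e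
      = Sigma.mk (𝒢.Δ.t a) '' Set.range fun y => γ (𝒢.Φ a (ε y)) := by
  ext x
  constructor
  · rintro ⟨b, hb, rfl⟩
    obtain ⟨y, hy⟩ := S.exists_pA (congrArg _ ha) hb
    exact ⟨_, ⟨y, rfl⟩, (h b hb y hy).symm⟩
  · rintro ⟨_, ⟨y, rfl⟩, rfl⟩
    obtain ⟨b, hb, hy⟩ := S.exists_of_pA (congrArg _ ha) y
    exact ⟨b, hb, h b hb y hy⟩

theorem range_translate {a : 𝒢.Δ.A} (ε : Equiv.Perm (𝒢.Y (𝒢.Δ.edge a)))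
    (γ : Equiv.Perm (𝒢.X (𝒢.Δ.t a))) :
    (Set.range fun y => γ (𝒢.Φ a (ε y))) = γ '' Set.range (𝒢.Φ a) := by
  rw [← Set.range_comp]
  exact ε.surjective.range_comp (γ ∘ 𝒢.Φ a)

/-- Arcs with the same terminus and the same image in the base graph whose bundles have the same
termini are equal. -/
theorem arc_eq_of_image_eq {e e' : S.T.A} (ht : S.T.t e = S.T.t e') (hπ : S.π.onA e = S.π.onA e')
    (h : S.Γ.t '' S.arcBundle e = S.Γ.t '' S.arcBundle e') : e = e' := by
  obtain ⟨ε, ⟨γ, hγ, hγe⟩, -⟩ := S.exists_isTranslate (e := e) rfl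
  have himg := IsTranslate.image_arcBundle rfl hγe
  rw [range_translate] at himg
  refine (S.existsUnique_arc (S.T.t e) (S.π.onA e) (S.π.map_t e) _ ⟨γ, hγ, rfl⟩).unique
    ⟨rfl, rfl, himg⟩ ⟨hπ.symm, ht.symm, ?_⟩
  rw [← himg]
  have : ∀ e, (fun c => S.pV (S.Γ.t c)) '' S.arcBundle e = S.pV '' (S.Γ.t '' S.arcBundle e) :=
    fun e => (Set.image_image _ _ _).symm
  rw [this, this, h]

/-- A local isomorphism maps an arc at a vertex to an arc at the image of the vertex. -/
theorem IsLocalIso.exists_arc {u' : S.T.V} {e : S.T.A} {f : S.Γ.V → S.Γ.V}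
    (hf : S.IsLocalIso (S.T.t e) u' f) :
    ∃ e', S.T.t e' = u' ∧ S.π.onA e' = S.π.onA e ∧
      ∃ k : Equiv.Perm (𝒢.Y (𝒢.Δ.edge (S.π.onA e))),
        ∀ b b', S.ArcRel e e' k b b' → f (S.Γ.t b) = S.Γ.t b' := by
  obtain ⟨σ, hσ, hσf⟩ := hf.exists_actsAs (S.pi_t (e := e) rfl)
  obtain ⟨ε, ⟨γ, hγ, hγe⟩, -⟩ := S.exists_isTranslate (e := e) rfl
  obtain ⟨e', ⟨hπ, ht, himg⟩, -⟩ := S.existsUnique_arc u' (S.π.onA e)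
    ((S.π.map_t e).trans hf.pi_eq.symm) _ ⟨σ * γ, mul_mem hσ hγ, rfl⟩
  obtain ⟨ε', ⟨γ', hγ', hγe'⟩, -⟩ := S.exists_isTranslate hπ
  have himg' := IsTranslate.image_arcBundle hπ hγe'
  rw [himg, ← range_translate ε] at himg'
  have hrange := sigma_mk_injective.image_injective himg'
  -- Two injective parametrisations of the same adhesion set differ by a permutation of the
  -- parameters; at this stage nothing is claimed about its relation to `H`.
  obtain ⟨k, hk⟩ := Function.Injective.exists_perm_comp_eq
    (f := fun y => γ' (𝒢.Φ _ (ε' y))) (g := fun y => (σ * γ) (𝒢.Φ _ (ε y)))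
    (γ'.injective.comp ((𝒢.Φ _).injective.comp ε'.injective))
    ((σ * γ).injective.comp ((𝒢.Φ _).injective.comp ε.injective)) hrange.symm
  refine ⟨e', ht, hπ, k, ?_⟩
  rintro b b' ⟨hb, hb', y, hy, hy'⟩
  have hb1 := S.mkV_t hb
  refine S.eq_of_pV_eq ((hσf _ hb1).1.trans (ht.symm.trans (S.mkV_t hb').symm)) ?_
  rw [(hσf _ hb1).2 _ (hγe b hb y hy), hγe' b' hb' _ hy']
  exact congrArg (Sigma.mk _) (hk y).symm

end GraphOfActions.Scaffolding

namespace GraphOfActions.Scaffolding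

variable {𝒢 : GraphOfActions.{u₁, u₂, u₃, u₄}} {S : Scaffolding.{u₁, u₂, u₃, u₄, u₅, u₆} 𝒢}

/-! ### Extending local isomorphisms to automorphisms -/

variable (S) in
/-- The maps `f` and `f'` on the vertices induce the same bijection between the bundles of the arcs
`e` and `e'`, at the termini and at the origins respectively. -/
def LinkedAlong (e e' : S.T.A) (f f' : S.Γ.V → S.Γ.V) : Prop :=
  S.π.onA e' = S.π.onA e ∧ ∃ i, 𝒢.Δ.edge (S.π.onA e) = i ∧ ∃ k : Equiv.Perm (𝒢.Y i),
    ∀ b b', S.ArcRel e e' k b b' → f (S.Γ.t b) = S.Γ.t b' ∧ f' (S.Γ.o b) = S.Γ.o b'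

theorem LinkedAlong.rev {e e' : S.T.A} {f f' : S.Γ.V → S.Γ.V} (h : S.LinkedAlong e e' f f') :
    S.LinkedAlong (S.T.rev e) (S.T.rev e') f' f := by
  obtain ⟨hπ, i, hi, k, hk⟩ := h
  refine ⟨by rw [S.pi_rev hπ, S.pi_rev rfl], i, ?_, k, fun b b' hb => ?_⟩
  · rw [S.pi_rev rfl, 𝒢.Δ.edge_rev, hi]
  · have h := hb.rev
    rw [S.T.rev_rev, S.T.rev_rev] at h
    have := hk _ _ h
    rw [← S.Γ.o_eq, ← S.Γ.o_eq, ← S.Γ.t_eq, ← S.Γ.t_eq] at this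
    exact this.symm

theorem LinkedAlong.exists_right {e e' : S.T.A} {f f' : S.Γ.V → S.Γ.V}
    (h : S.LinkedAlong e e' f f') {b : S.Γ.A} (hb : S.mkA b = e) :
    ∃ b', S.mkA b' = e' ∧ f (S.Γ.t b) = S.Γ.t b' ∧ f' (S.Γ.o b) = S.Γ.o b' := by
  obtain ⟨hπ, i, hi, k, hk⟩ := h
  obtain ⟨b', hb'⟩ := exists_arcRel_right (e' := e') hi (by rw [hπ, hi]) k hb
  exact ⟨b', hb'.2.1, hk b b' hb'⟩

theorem LinkedAlong.exists_left {e e' : S.T.A} {f f' : S.Γ.V → S.Γ.V}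
    (h : S.LinkedAlong e e' f f') {b' : S.Γ.A} (hb' : S.mkA b' = e') :
    ∃ b, S.mkA b = e ∧ f (S.Γ.t b) = S.Γ.t b' ∧ f' (S.Γ.o b) = S.Γ.o b' := by
  obtain ⟨hπ, i, hi, k, hk⟩ := h
  obtain ⟨b, hb⟩ := exists_arcRel_left (e' := e') hi (by rw [hπ, hi]) k hb'
  exact ⟨b, hb.1, hk b b' hb⟩

theorem LinkedAlong.image_eq {e e' : S.T.A} {f f' : S.Γ.V → S.Γ.V}
    (h : S.LinkedAlong e e' f f') :
    f '' (S.Γ.t '' S.arcBundle e) = S.Γ.t '' S.arcBundle e' := by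
  ext w
  constructor
  · rintro ⟨_, ⟨b, hb, rfl⟩, rfl⟩
    obtain ⟨b', hb', ht, -⟩ := h.exists_right hb
    exact ⟨b', hb', ht.symm⟩
  · rintro ⟨b', hb', rfl⟩
    obtain ⟨b, hb, ht, -⟩ := h.exists_left hb'
    exact ⟨_, ⟨b, hb, rfl⟩, ht⟩

theorem toSimple_adj_of_arc (e : S.T.A) : S.T.toSimple.Adj (S.T.t e) (S.T.o e) :=
  SimpleGraph.Adj.symm ⟨S.isTree.1.1 e, e, rfl, rfl⟩

theorem exists_arc_of_adj {u w : S.T.V} (h : S.T.toSimple.Adj u w) :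
    ∃ e, S.T.t e = u ∧ S.T.o e = w := by
  obtain ⟨-, e, ho, ht⟩ := h.symm
  exact ⟨e, ht, ho⟩

variable (S) in
/-- A family of local isomorphisms, one at each vertex of the tree, that are linked along all
arcs. -/
structure IsCompatibleFamily (θ : S.T.V → S.T.V) (f : S.T.V → S.Γ.V → S.Γ.V) : Prop where
  isLocalIso : ∀ u, S.IsLocalIso u (θ u) (f u)
  linked : ∀ e, ∃ e', S.T.t e' = θ (S.T.t e) ∧ S.T.o e' = θ (S.T.o e) ∧
    S.LinkedAlong e e' (f (S.T.t e)) (f (S.T.o e))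

/-- A local isomorphism extends to a compatible family of local isomorphisms. -/
theorem IsLocalIso.exists_family {r r' : S.T.V} {f₀ : S.Γ.V → S.Γ.V}
    (h₀ : S.IsLocalIso r r' f₀) :
    ∃ θ f, S.IsCompatibleFamily θ f ∧ f r = f₀ := by
  let M : S.T.V → Type _ := fun u =>
    {m : S.T.V × (S.Γ.V → S.Γ.V) // S.IsLocalIso u m.1 m.2}
  let R : ∀ u w, M u → M w → Prop := fun u w m n =>
    ∃ e e', S.T.t e = u ∧ S.T.o e = w ∧ S.T.t e' = m.1.1 ∧ S.T.o e' = n.1.1 ∧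
      S.LinkedAlong e e' m.1.2 n.1.2
  obtain ⟨m, hmr, hm⟩ := S.isTree.2.exists_compatible_family R
    (by
      rintro u w m n ⟨e, e', hu, hw, hu', hw', h⟩
      refine ⟨S.T.rev e, S.T.rev e', ?_, ?_, ?_, ?_, h.rev⟩
      · rw [← S.T.o_eq, hw]
      · rw [← S.T.t_eq, hu]
      · rw [← S.T.o_eq, hw']
      · rw [← S.T.t_eq, hu'])
    (by
      rintro u w h ⟨⟨u', f⟩, hf⟩
      obtain ⟨e, rfl, rfl⟩ := exists_arc_of_adj h
      obtain ⟨e', rfl, hπ, k, hk⟩ := hf.exists_arc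
      obtain ⟨f', hf', hk'⟩ := hf.exists_origin rfl hπ hk
      exact ⟨⟨(_, f'), hf'⟩, e, e', rfl, rfl, rfl, rfl, hπ, _, rfl, k,
        fun b b' hb => ⟨hk b b' hb, hk' b b' hb⟩⟩)
    r ⟨(r', f₀), h₀⟩
  refine ⟨fun u => (m u).1.1, fun u => (m u).1.2, ⟨fun u => (m u).2, fun e => ?_⟩,
    by simp only [hmr]⟩
  obtain ⟨e₁, e', ht, ho, ht', ho', h⟩ := hm _ _ (toSimple_adj_of_arc e)
  -- The family is linked along some arc with the given ends, and simplicity of the tree makes this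
  -- the given arc.
  obtain rfl : e₁ = e := S.arc_ext ho ht
  exact ⟨e', ht', ho', h⟩

namespace IsCompatibleFamily

variable {θ : S.T.V → S.T.V} {f : S.T.V → S.Γ.V → S.Γ.V}

theorem adj_map (h : S.IsCompatibleFamily θ f) {u w : S.T.V} (huw : S.T.toSimple.Adj u w) :
    S.T.toSimple.Adj (θ u) (θ w) := by
  obtain ⟨e, rfl, rfl⟩ := exists_arc_of_adj huw
  obtain ⟨e', ht, ho, -⟩ := h.linked e
  rw [← ht, ← ho]
  exact toSimple_adj_of_arc e'

/-- Two neighbours of `u` with the same image lead to the same image arc, so their arc bundles have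
the same termini after applying `f u`. This map is injective on the bundle, so the two arcs at `u`
share an adhesion set and coincide. -/
theorem injective (h : S.IsCompatibleFamily θ f) : Function.Injective θ := by
  refine S.isTree.2.injective_of_injOn_neighborSet S.isTree.2.isAcyclic
    (⟨θ, h.adj_map⟩ : S.T.toSimple →g S.T.toSimple) fun u w₁ hw₁ w₂ hw₂ hw => ?_
  change θ w₁ = θ w₂ at hw
  obtain ⟨e₁, hu₁, rfl⟩ := exists_arc_of_adj hw₁
  obtain ⟨e₂, hu₂, rfl⟩ := exists_arc_of_adj hw₂
  obtain ⟨e', ht, ho, hl⟩ := h.linked e₁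
  obtain ⟨e'', ht', ho', hl'⟩ := h.linked e₂
  rw [hu₁] at hl ht
  rw [hu₂] at hl' ht'
  obtain rfl : e' = e'' := S.arc_ext (ho.trans (hw.trans ho'.symm)) (ht.trans ht'.symm)
  have himg := hl.image_eq.trans hl'.image_eq.symm
  congr 1
  refine S.arc_eq_of_image_eq (hu₁.trans hu₂.symm) (hl.1.symm.trans hl'.1) ?_
  have hinj : Set.InjOn (f u) {w | S.mkV w = u} :=
    fun _ hw _ hw' hf => (h.isLocalIso u).injOn hw hw' hf
  refine (hinj.image_eq_image_iff ?_ ?_).1 himg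
  · rintro _ ⟨b, hb, rfl⟩
    exact (S.mkV_t hb).trans hu₁
  · rintro _ ⟨b, hb, rfl⟩
    exact (S.mkV_t hb).trans hu₂

end IsCompatibleFamily

/-- Every arc at the image of a vertex under a local isomorphism is the image of an arc. -/
theorem IsLocalIso.exists_arc_left {u : S.T.V} {e' : S.T.A} {f : S.Γ.V → S.Γ.V}
    (hf : S.IsLocalIso u (S.T.t e') f) :
    ∃ e, S.T.t e = u ∧ S.π.onA e = S.π.onA e' ∧
      f '' (S.Γ.t '' S.arcBundle e) = S.Γ.t '' S.arcBundle e' := by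
  have hu : S.π.onV u = 𝒢.Δ.t (S.π.onA e') := hf.pi_eq.symm.trans (S.pi_t rfl)
  obtain ⟨σ, hσ, hσf⟩ := hf.exists_actsAs hu
  -- The inverse of `f` on the bundle is again a local isomorphism, and the arc sought is the image
  -- of `e'` under it.
  obtain ⟨g, hg⟩ := S.exists_actsAs (S.pi_t rfl) hu σ⁻¹
  have hfg : ∀ w, S.mkV w = S.T.t e' → f (g w) = w := by
    intro w hw
    obtain ⟨x, hx⟩ := S.exists_pV (S.pi_t rfl) hw
    refine S.eq_of_pV_eq ((hσf _ (hg w hw).1).1.trans hw.symm) ?_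
    rw [(hσf _ (hg w hw).1).2 _ ((hg w hw).2 x hx), hx]
    exact congrArg (Sigma.mk _) (σ.apply_symm_apply x)
  have hg' : S.IsLocalIso (S.T.t e') u g := ⟨_, S.pi_t rfl, hu, _, inv_mem hσ, hg⟩
  obtain ⟨e, ht, hπ, k, hk⟩ := hg'.exists_arc
  refine ⟨e, ht, hπ, ?_⟩
  have key : ∀ b b', S.ArcRel e' e k b' b → f (S.Γ.t b) = S.Γ.t b' := by
    intro b b' hb
    rw [← hk _ _ hb, hfg _ (S.mkV_t hb.1)]
  ext w
  constructor
  · rintro ⟨_, ⟨b, hb, rfl⟩, rfl⟩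
    obtain ⟨b', hb'⟩ := exists_arcRel_left (e := e') rfl (congrArg _ hπ) k hb
    exact ⟨b', hb'.1, (key _ _ hb').symm⟩
  · rintro ⟨b', hb', rfl⟩
    obtain ⟨b, hb⟩ := exists_arcRel_right (e' := e) rfl (congrArg _ hπ) k hb'
    exact ⟨_, ⟨b, hb.2.1, rfl⟩, key _ _ hb⟩

namespace IsCompatibleFamily

variable {θ : S.T.V → S.T.V} {f : S.T.V → S.Γ.V → S.Γ.V}

/-- The arc linked to the preimage of `e'` has the same termini in its bundle as `e'`, hence equals
`e'`. -/
theorem exists_linked_left (h : S.IsCompatibleFamily θ f) {u : S.T.V} {e' : S.T.A}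
    (hu : S.T.t e' = θ u) :
    ∃ e, S.T.t e = u ∧ S.T.o e' = θ (S.T.o e) ∧
      S.LinkedAlong e e' (f (S.T.t e)) (f (S.T.o e)) := by
  have hf := h.isLocalIso u
  rw [← hu] at hf
  obtain ⟨e, rfl, hπ, himg⟩ := hf.exists_arc_left
  obtain ⟨e'', ht, ho, hl⟩ := h.linked e
  obtain rfl : e'' = e' := S.arc_eq_of_image_eq (ht.trans hu.symm) (hl.1.trans hπ)
    (hl.image_eq.symm.trans himg)
  exact ⟨e, rfl, ho, hl⟩

theorem surjective (h : S.IsCompatibleFamily θ f) : Function.Surjective θ := by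
  have : Nonempty S.T.V := S.isTree.2.1.nonempty
  refine S.isTree.2.1.surjective_of_neighbor_mem_range θ fun u w huw => ?_
  obtain ⟨e', ht, rfl⟩ := exists_arc_of_adj huw
  obtain ⟨e, -, ho, -⟩ := h.exists_linked_left ht
  exact ⟨_, ho.symm⟩

theorem mkV_apply (h : S.IsCompatibleFamily θ f) (v : S.Γ.V) :
    S.mkV (f (S.mkV v) v) = θ (S.mkV v) :=
  (h.isLocalIso _).mapsTo rfl

theorem bijective (h : S.IsCompatibleFamily θ f) :
    Function.Bijective fun v => f (S.mkV v) v := by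
  constructor
  · intro v w hvw
    change f (S.mkV v) v = f (S.mkV w) w at hvw
    have hθ : θ (S.mkV v) = θ (S.mkV w) := by
      rw [← h.mkV_apply, ← h.mkV_apply, hvw]
    have hu := h.injective hθ
    rw [hu] at hvw
    exact (h.isLocalIso _).injOn hu rfl hvw
  · intro w
    obtain ⟨u, hu⟩ := h.surjective (S.mkV w)
    obtain ⟨v, rfl, hv⟩ := (h.isLocalIso u).surjOn hu.symm
    exact ⟨v, hv⟩

theorem exists_arc (h : S.IsCompatibleFamily θ f) (b : S.Γ.A) :
    ∃ b', S.Γ.o b' = f (S.mkV (S.Γ.o b)) (S.Γ.o b) ∧ S.Γ.t b' = f (S.mkV (S.Γ.t b)) (S.Γ.t b) ∧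
      S.π.onA (S.mkA b') = S.π.onA (S.mkA b) := by
  obtain ⟨e', -, -, hl⟩ := h.linked (S.mkA b)
  obtain ⟨b', hb', ht, ho⟩ := hl.exists_right rfl
  exact ⟨b', ho.symm, ht.symm, by rw [hb', hl.1]⟩

theorem exists_arc_left (h : S.IsCompatibleFamily θ f) (b' : S.Γ.A) :
    ∃ b, S.Γ.o b' = f (S.mkV (S.Γ.o b)) (S.Γ.o b) ∧
      S.Γ.t b' = f (S.mkV (S.Γ.t b)) (S.Γ.t b) := by
  obtain ⟨u, hu⟩ := h.surjective (S.T.t (S.mkA b'))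
  obtain ⟨e, rfl, -, hl⟩ := h.exists_linked_left hu.symm
  obtain ⟨b, rfl, ht, ho⟩ := hl.exists_left rfl
  exact ⟨b, ho.symm, ht.symm⟩

/-- A compatible family of local isomorphisms is induced by an element of the universal group. -/
theorem exists_mem_universalGroup (h : S.IsCompatibleFamily θ f) :
    ∃ g ∈ S.universalGroup, ∀ v : S.Γ.V, g • v = f (S.mkV v) v := by
  choose α hαo hαt hαπ using h.exists_arc
  have hα : Function.Bijective α := by
    constructor
    · intro b c hbc
      refine S.arc_eq_of_ends_eq (h.bijective.1 ?_) (h.bijective.1 ?_)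
      · change f _ _ = f _ _
        rw [← hαo, ← hαo, hbc]
      · change f _ _ = f _ _
        rw [← hαt, ← hαt, hbc]
    · intro b'
      obtain ⟨b, ho, ht⟩ := h.exists_arc_left b'
      exact ⟨b, S.arc_eq_of_ends_eq ((hαo b).trans ho.symm) ((hαt b).trans ht.symm)⟩
  let g : S.Γ.Aut := ⟨(Equiv.ofBijective _ h.bijective, Equiv.ofBijective α hα), fun b => by
    refine ⟨hαo b, hαt b, S.arc_eq_of_ends_eq ?_ ?_⟩
    · change S.Γ.o (S.Γ.rev (α b)) = S.Γ.o (α (S.Γ.rev b))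
      rw [← S.Γ.t_eq, hαt, hαo, ← S.Γ.t_eq]
    · change S.Γ.t (S.Γ.rev (α b)) = S.Γ.t (α (S.Γ.rev b))
      rw [← S.Γ.o_eq, hαt, hαo, ← S.Γ.o_eq]⟩
  have hg : ∀ v : S.Γ.V, g • v = f (S.mkV v) v := fun v => rfl
  refine ⟨g, ⟨⟨fun v w => ?_, fun v => ?_, hαπ⟩, fun u => ?_⟩, hg⟩
  · have h1 : S.r (g • v) (g • w) ↔ S.mkV (g • v) = S.mkV (g • w) := Quotient.eq.symm
    have h2 : S.r v w ↔ S.mkV v = S.mkV w := Quotient.eq.symm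
    rw [h1, h2, hg, hg, h.mkV_apply, h.mkV_apply, h.injective.eq_iff]
  · rw [hg, h.mkV_apply, (h.isLocalIso _).pi_eq]
  · obtain ⟨σ, hσ, hf⟩ := (h.isLocalIso u).exists_actsAs rfl
    refine ⟨σ, hσ, fun w hw x hx => ?_⟩
    obtain rfl : S.mkV w = u := hw
    exact (hf w rfl).2 x hx

end IsCompatibleFamily

/-- Every local isomorphism extends to an element of the universal group. -/
theorem IsLocalIso.exists_mem_universalGroup {u u' : S.T.V} {f₀ : S.Γ.V → S.Γ.V}
    (h₀ : S.IsLocalIso u u' f₀) :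
    ∃ g ∈ S.universalGroup, ∀ v : S.Γ.V, S.mkV v = u → g • v = f₀ v := by
  obtain ⟨θ, f, h, hf⟩ := h₀.exists_family
  obtain ⟨g, hg, hgf⟩ := h.exists_mem_universalGroup
  refine ⟨g, hg, fun v hv => ?_⟩
  rw [hgf, hv, hf]

end GraphOfActions.Scaffolding

namespace GraphOfActions.Scaffolding

variable {𝒢 : GraphOfActions.{u₁, u₂, u₃, u₄}} (S : Scaffolding.{u₁, u₂, u₃, u₄, u₅, u₆} 𝒢)

/-! ### The actions on the bundles -/

theorem exists_vertexBundle_equiv (u : S.T.V) :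
    ∃ Φ : S.vertexBundle u ≃ 𝒢.X (S.π.onV u), ∀ w : S.vertexBundle u, S.pV w = ⟨S.π.onV u, Φ w⟩ := by
  choose Φ hΦ using fun w : S.vertexBundle u => S.exists_pV rfl w.2
  refine ⟨Equiv.ofBijective Φ ⟨fun w w' h => Subtype.ext ?_, fun x => ?_⟩, hΦ⟩
  · exact S.eq_of_pV_eq (w.2.trans w'.2.symm) (by rw [hΦ, hΦ, h])
  · obtain ⟨w, hw, hx⟩ := S.exists_of_pV rfl x
    exact ⟨⟨w, hw⟩, eq_of_heq (Sigma.mk.inj ((hΦ ⟨w, hw⟩).symm.trans hx)).2⟩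

theorem exists_arcBundle_equiv (e : S.T.A) :
    ∃ Φ : S.arcBundle e ≃ 𝒢.Y (𝒢.Δ.edge (S.π.onA e)),
      ∀ b : S.arcBundle e, S.pA b = ⟨𝒢.Δ.edge (S.π.onA e), Φ b⟩ := by
  choose Φ hΦ using fun b : S.arcBundle e => S.exists_pA rfl b.2
  refine ⟨Equiv.ofBijective Φ ⟨fun b b' h => Subtype.ext ?_, fun y => ?_⟩, hΦ⟩
  · exact S.eq_of_pA_eq (b.2.trans b'.2.symm) (by rw [hΦ, hΦ, h])
  · obtain ⟨b, hb, hy⟩ := S.exists_of_pA rfl y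
    exact ⟨⟨b, hb⟩, eq_of_heq (Sigma.mk.inj ((hΦ ⟨b, hb⟩).symm.trans hy)).2⟩

theorem induced_vertexBundle_isomorphic (u : S.T.V) :
    ActionIso.Isomorphic (ActionIso.induced S.universalGroup (S.vertexBundle u))
      (S.vertexBundle u) (𝒢.G (S.π.onV u)) (𝒢.X (S.π.onV u)) := by
  obtain ⟨Φ, hΦ⟩ := S.exists_vertexBundle_equiv u
  refine ActionIso.isomorphic_of_permCongr Φ fun k => ?_
  rw [ActionIso.mem_induced_iff]
  constructor
  · rintro ⟨g, hg⟩
    obtain ⟨σ, hσ, hgσ⟩ := g.2.2 u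
    convert hσ
    ext x
    obtain ⟨w, rfl⟩ := Φ.surjective x
    rw [Equiv.permCongr_apply, Φ.symm_apply_apply]
    have h := hgσ w w.2 _ (hΦ w)
    have h' : S.pV (g.1 • (w : S.Γ.V)) = _ := (congrArg S.pV (hg w)).symm.trans (hΦ (k w))
    exact eq_of_heq (Sigma.mk.inj (h'.symm.trans h)).2
  · intro hk
    obtain ⟨f, hf⟩ := S.exists_actsAs (u := u) (u' := u) rfl rfl (Φ.permCongr k)
    have hloc : S.IsLocalIso u u f := ⟨_, rfl, rfl, _, hk, hf⟩
    obtain ⟨g, hg, hgf⟩ := hloc.exists_mem_universalGroup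
    refine ⟨⟨g, hg⟩, fun w => ?_⟩
    change _ = g • (w : S.Γ.V)
    rw [hgf w w.2]
    refine S.eq_of_pV_eq ((k w).2.trans (hf w w.2).1.symm) ?_
    rw [(hf w w.2).2 _ (hΦ w), hΦ, Equiv.permCongr_apply, Φ.symm_apply_apply]

variable {S}

theorem IsScaffoldingAut.mkV_smul_eq_iff {g : S.Γ.Aut} (hg : S.IsScaffoldingAut g)
    {v w : S.Γ.V} : S.mkV (g • v) = S.mkV (g • w) ↔ S.mkV v = S.mkV w := by
  have h1 : S.r (g • v) (g • w) ↔ S.mkV (g • v) = S.mkV (g • w) := Quotient.eq.symm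
  have h2 : S.r v w ↔ S.mkV v = S.mkV w := Quotient.eq.symm
  rw [← h1, ← h2, hg.1]

theorem t_smul (g : S.Γ.Aut) (b : S.Γ.A) : S.Γ.t (g • b) = g • S.Γ.t b := (g.2 b).2.1

theorem o_smul (g : S.Γ.Aut) (b : S.Γ.A) : S.Γ.o (g • b) = g • S.Γ.o b := (g.2 b).1

theorem IsScaffoldingAut.mkA_smul_eq_iff {g : S.Γ.Aut} (hg : S.IsScaffoldingAut g)
    {b c : S.Γ.A} : S.mkA (g • b) = S.mkA (g • c) ↔ S.mkA b = S.mkA c := by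
  have key : ∀ b c : S.Γ.A, S.mkA b = S.mkA c ↔
      S.mkV (S.Γ.o b) = S.mkV (S.Γ.o c) ∧ S.mkV (S.Γ.t b) = S.mkV (S.Γ.t c) :=
    fun b c => ⟨fun h => ⟨congrArg S.T.o h, congrArg S.T.t h⟩, fun h => S.arc_ext h.1 h.2⟩
  rw [key, key, o_smul, o_smul, t_smul, t_smul, hg.mkV_smul_eq_iff, hg.mkV_smul_eq_iff]

variable (S)

theorem induced_arcBundle_isomorphic (e : S.T.A) :
    ActionIso.Isomorphic (ActionIso.induced S.universalGroup (S.arcBundle e))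
      (S.arcBundle e) (𝒢.H (𝒢.Δ.edge (S.π.onA e))) (𝒢.Y (𝒢.Δ.edge (S.π.onA e))) := by
  obtain ⟨Φ, hΦ⟩ := S.exists_arcBundle_equiv e
  refine ActionIso.isomorphic_of_permCongr Φ fun k => ?_
  have hrel : ∀ b : S.arcBundle e, S.ArcRel e e (Φ.permCongr k) b (k b) := fun b =>
    ⟨b.2, (k b).2, Φ b, hΦ b, by
      rw [hΦ, Equiv.permCongr_apply, Φ.symm_apply_apply]⟩
  obtain ⟨ε, hε, hnorm⟩ := S.exists_isTranslate (e := e) rfl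
  rw [ActionIso.mem_induced_iff]
  constructor
  · rintro ⟨⟨g, hgU⟩, hg⟩
    change ∀ b : S.arcBundle e, (k b : S.Γ.A) = g • (b : S.Γ.A) at hg
    obtain ⟨b₀, hb₀⟩ := Quotient.exists_rep e
    have hmap : ∀ w, S.mkV w = S.T.t e → S.mkV (g • w) = S.T.t e := by
      -- An arc `b₀` of the bundle is sent to `k b₀` in the same bundle, so `g` preserves the vertex
      -- bundle at the terminus.
      intro w hw
      rw [← S.mkV_t (k ⟨b₀, hb₀⟩).2, hg, t_smul, hgU.1.mkV_smul_eq_iff, hw, S.mkV_t hb₀]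
    have hloc : S.IsLocalIso (S.T.t e) (S.T.t e) (g • ·) := by
      obtain ⟨σ, hσ, hgσ⟩ := hgU.2 (S.T.t e)
      exact ⟨_, rfl, rfl, σ, hσ, fun w hw => ⟨hmap w hw, hgσ w hw⟩⟩
    refine (hnorm _).1 (hε.conj_mem rfl rfl hε hloc ?_)
    rintro b b' ⟨hb, hb', y, hy, hy'⟩
    obtain ⟨-, -, y₁, hy₁, hy₁'⟩ := hrel ⟨b, hb⟩
    have hyy : y₁ = y := eq_of_heq (Sigma.mk.inj (hy₁.symm.trans hy)).2
    have hkb : (k ⟨b, hb⟩ : S.Γ.A) = b' :=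
      S.eq_of_pA_eq ((k ⟨b, hb⟩).2.trans hb'.symm) (by rw [hy₁', hyy, hy'])
    rw [← hkb, hg, t_smul]
  · intro hk
    obtain ⟨f, hf, hfk⟩ := hε.exists_isLocalIso rfl rfl hε ((hnorm _).2 hk)
    obtain ⟨g, hg, hgf⟩ := hf.exists_mem_universalGroup
    have ht : ∀ b : S.arcBundle e, S.Γ.t (g • (b : S.Γ.A)) = S.Γ.t (k b) := fun b => by
      rw [t_smul, hgf _ (S.mkV_t b.2), hfk _ _ (hrel b)]
    refine ⟨⟨g, hg⟩, fun b => ?_⟩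
    change _ = g • (b : S.Γ.A)
    -- Knowing the termini of the arcs `g • b` is not enough, as arcs of different bundles may share
    -- a terminus. But `g` carries the set of termini of the whole bundle to itself, and this set
    -- identifies the arc of the tree.
    have hclass : S.mkA (g • (b : S.Γ.A)) = e := by
      refine S.arc_eq_of_image_eq ?_ ?_ ?_
      · rw [t_mkA, ht, S.mkV_t (k b).2]
      · rw [hg.1.2.2, b.2]
      · ext w
        constructor
        · rintro ⟨c, hc, rfl⟩
          have hc' : S.mkA (g⁻¹ • c) = e := by
            rw [← show S.mkA (b : S.Γ.A) = e from b.2, ← hg.1.mkA_smul_eq_iff, smul_inv_smul]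
            exact hc
          have h := ht ⟨_, hc'⟩
          rw [smul_inv_smul] at h
          exact ⟨_, (k ⟨_, hc'⟩).2, h.symm⟩
        · rintro ⟨c, hc, rfl⟩
          obtain ⟨c', hc'⟩ := k.surjective ⟨c, hc⟩
          refine ⟨g • (c' : S.Γ.A), hg.1.mkA_smul_eq_iff.2 (c'.2.trans b.2.symm), ?_⟩
          rw [ht, hc']
    exact S.arc_eq_of_t_eq ((k b).2.trans hclass.symm) (ht b).symm

end GraphOfActions.Scaffolding

theorem mainTheorem5 (𝒢 : GraphOfActions) (S : 𝒢.Scaffolding) :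
    (∀ v : S.Γ.V,
      ActionIso.Isomorphic
        (ActionIso.induced S.universalGroup (S.vertexBundle (S.mkV v)))
        (S.vertexBundle (S.mkV v))
        (𝒢.G (S.π.onV (S.mkV v)))
        (𝒢.X (S.π.onV (S.mkV v)))) ∧
    (∀ a : S.Γ.A,
      ActionIso.Isomorphic
        (ActionIso.induced S.universalGroup (S.arcBundle (S.mkA a)))
        (S.arcBundle (S.mkA a))
        (𝒢.H (𝒢.Δ.edge (S.π.onA (S.mkA a))))
        (𝒢.Y (𝒢.Δ.edge (S.π.onA (S.mkA a))))) :=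
  ⟨fun v => S.induced_vertexBundle_isomorphic (S.mkV v),
    fun a => S.induced_arcBundle_isomorphic (S.mkA a)⟩
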